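/- **Transformer encoders.** Let $\Sigma=\{a_1,\dots,a_s\}$ be a finite alphabet. An encoder $T\in\mathcal T_{udec}$ over $\Sigma$ embeds the symbol $a_k$ at position $i$ of a word as $(\delta,1,i,\sum_{j=0}^{i}j,k)\in\mathbb{Q}^5$, where $\delta=1$ at the first position and $\delta=0$ elsewhere. Positions are counted from $p$ on, with a convention $p\in\{0,1\}$ that is fixed once and for all. Then $T$ applies $L\ge 1$ layers. A layer has $h\ge1$ attention heads, each given by matrices $Q,K,W$ and a feedforward network $N$ with one input and one output. On a sequence $x_1,\dots,x_n$ and at position $m$, a head computes the scores $s_i=N(\langle Qx_m,Kx_i\rangle)$ and the vector $\sum_{i=1}^n\mathrm{hardmax}(i,s_1,\dots,s_n)\,Wx_i$, where $\mathrm{hardmax}(i,s_1,\dots,s_n)$ is $1/r$ if $s_i$ is maximal and the maximum is attained at exactly $r$ positions, and $0$ if $s_i$ is not maximal. The layer replaces $x_m$ by the value of a feedforward network at the concatenation of $x_m$ and the outputs of its heads. The output $T(w)$ is the value of a final feedforward network, with one output, at the last vector of the last layer. All feedforward networks have relu activations in their hidden layers and an affine output layer, and all parameters are rational numbers. **Log-precision.**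 A fixed-point arithmetic with $I$ integer bits and $f$ fractional bits represents the numbers $k/2^f$ with $-2^{I+f}\le k<2^{I+f}$. Results that are not representable are rounded (down, up, towards zero, or to nearest), and overflow is handled by saturation or by wrap-around. A log-precision arithmetic $F$ is a choice of a rounding mode, of an overflow mode and of constants $\alpha,\beta,\alpha',\beta'\in\mathbb N$. On words of length $n$ it is the fixed-point arithmetic with $\alpha\ell+\beta$ integer bits and $\alpha'\ell+\beta'$ fractional bits, where $\ell=\lfloor\log_2\max(|\Sigma|,n)\rfloor+1$. That $T$ works over $F$ means that its parameters, its embedding and every operation in the computation of $T(w)$ are rounded to this arithmetic. Let $\mathcal T_{udec}^{\log}$ be the class of all pairs of an encoder $T\in\mathcal T_{udec}$ and a log-precision arithmetic $F$ over which it works. **Theorem 2.** The problem $\mathrm{trSAT}[\mathcal T_{udec}^{\log}]$ (given $T\in\mathcal T_{udec}^{\log}$, is there a non-empty word $w$ over its alphabet with $T(w)=1$?) is undecidable. Moreover, there is a constant $c$ such that for every single log-precision arithmetic $F$ with $\alpha,\alpha'\ge c$ the problem is already undecidable for the encoders $T\in\mathcal T_{udec}$ that work over this fixed $F$. -/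

import Mathlib

namespace TransformerSat

/-! ## Fixed-width (fixed-point, two's complement) arithmetic -/

/-- How an arithmetic result that lies between two neighbouring grid points is rounded. -/
inductive Rounding
  | down
  | up
  | towardZero
  | nearest

/-- How an arithmetic result outside the range of the format is treated. -/
inductive Overflow
  | saturate
  | wrap

/-- Rounding of a rational number to an integer. -/
def Rounding.toInt : Rounding → ℚ → ℤ
  | .down, x => ⌊x⌋
  | .up, x => ⌈x⌉
  | .towardZero, x => if 0 ≤ x then ⌊x⌋ else ⌈x⌉
  | .nearest, x => round x

/-- Reduction of an integer to the range `-M, …, M - 1`. -/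
def Overflow.reduce : Overflow → ℕ → ℤ → ℤ
  | .saturate, M, k => max (-(M : ℤ)) (min k ((M : ℤ) - 1))
  | .wrap, M, k => Int.bmod k (2 * M)

/-- A fixed-point arithmetic: one sign bit, `intBits` integer bits and `fracBits` fractional bits.
The representable numbers are `k / 2 ^ fracBits` with
`-2 ^ (intBits + fracBits) ≤ k < 2 ^ (intBits + fracBits)`. -/
structure FixedPoint where
  rounding : Rounding
  overflow : Overflow
  intBits : ℕ
  fracBits : ℕ

namespace FixedPoint

/-- The number of bits of a value; there are `2 ^ F.bits` representable numbers. -/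
def bits (F : FixedPoint) : ℕ := 1 + F.intBits + F.fracBits

/-- The representable number that stands for the rational number `x` in `F`. -/
def rnd (F : FixedPoint) (x : ℚ) : ℚ :=
  (F.overflow.reduce (2 ^ (F.intBits + F.fracBits)) (F.rounding.toInt (x * 2 ^ F.fracBits)) : ℚ) /
    2 ^ F.fracBits

def add (F : FixedPoint) (x y : ℚ) : ℚ := F.rnd (x + y)

def mul (F : FixedPoint) (x y : ℚ) : ℚ := F.rnd (x * y)

/-- Summation from left to right, every partial sum being computed in `F`. -/
def sum (F : FixedPoint) (l : List ℚ) : ℚ := l.foldl F.add 0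

/-- The scalar product, computed in `F`. -/
def dot (F : FixedPoint) (u v : List ℚ) : ℚ := F.sum (List.zipWith F.mul u v)

end FixedPoint

/-- A family of fixed-point arithmetics of logarithmic precision: the numbers of integer and of
fractional bits are affine functions of the length `Nat.size N = ⌊log₂ N⌋ + 1` of the binary
representation of the parameter `N`. -/
structure LogPrecision where
  rounding : Rounding
  overflow : Overflow
  intRate : ℕ
  intConst : ℕ
  fracRate : ℕ
  fracConst : ℕ

/-- The member of the family for the parameter `N`. -/
def LogPrecision.at (F : LogPrecision) (N : ℕ) : FixedPoint where
  rounding := F.rounding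
  overflow := F.overflow
  intBits := F.intRate * Nat.size N + F.intConst
  fracBits := F.fracRate * Nat.size N + F.fracConst

/-! ## Transformer encoders -/

/-- A rational parameter: `(z, m)` stands for `z / (m + 1)`. -/
abbrev Param := ℤ × ℕ

def Param.val (p : Param) : ℚ := (p.1 : ℚ) / ((p.2 : ℚ) + 1)

/-- A matrix, given by its rows. -/
abbrev Mat := List (List Param)

/-- A neuron `x ↦ σ (b + ∑ i, w i * x i)`, given by its bias `b` and its weights `w`. -/
abbrev Neuron := Param × List Param

/-- A feedforward neural network with relu activations in the hidden layers and an affine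
output layer. -/
structure FNN where
  hidden : List (List Neuron)
  output : List Neuron

/-- An attention head with scoring `score (x, y) = N ⟨Q x, K y⟩` and with a pooling that has
`hardmax` as its normalisation and `W` as its linear map. -/
structure Head where
  Q : Mat
  K : Mat
  N : FNN
  W : Mat

structure Layer where
  heads : List Head
  comb : FNN

/-- A transformer encoder over the alphabet `a_1, …, a_s`, where `s` is `alphabetSize` and `a_k` is
the element `k - 1` of `Fin s`. The embedding is fixed, see `embed`. -/
structure TE where
  alphabetSize : ℕ
  layers : List Layer
  out : FNN

/-! ### Dimensions -/

/-- `M` has `c` columns. -/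
def Mat.HasCols (M : Mat) (c : ℕ) : Prop := ∀ r ∈ M, r.length = c

/-- All neurons of the list have `m` inputs. -/
def NeuronsFit (m : ℕ) (l : List Neuron) : Prop := ∀ v ∈ l, v.2.length = m

/-- The hidden layers `ls` followed by the output layer `o` fit together, with input dimension
`m`. -/
def LayersFit : ℕ → List (List Neuron) → List Neuron → Prop
  | m, [], o => NeuronsFit m o
  | m, l :: ls, o => NeuronsFit m l ∧ LayersFit l.length ls o

/-- `N` computes a function from vectors of dimension `m` to vectors of dimension `n`. -/
def FNN.HasDims (N : FNN) (m n : ℕ) : Prop :=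
  LayersFit m N.hidden N.output ∧ N.output.length = n

/-- `A` is an attention head on vectors of dimension `d`. -/
def Head.Fits (A : Head) (d : ℕ) : Prop :=
  Mat.HasCols A.Q d ∧ Mat.HasCols A.K d ∧ A.Q.length = A.K.length ∧ A.N.HasDims 1 1 ∧
    Mat.HasCols A.W d

/-- `l` is an encoder layer that maps vectors of dimension `d` to vectors of dimension
`l.comb.output.length`. -/
def Layer.Fits (l : Layer) (d : ℕ) : Prop :=
  l.heads ≠ [] ∧ (∀ A ∈ l.heads, A.Fits d) ∧
    l.comb.HasDims (d + (l.heads.map fun A => A.W.length).sum) l.comb.output.length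

/-- The layers `ls`, followed by the output function `o`, fit together on input vectors of
dimension `d`. -/
def EncoderFits : ℕ → List Layer → FNN → Prop
  | d, [], o => o.HasDims d 1
  | d, l :: ls, o => l.Fits d ∧ EncoderFits l.comb.output.length ls o

/-- All dimensions match, so that the data describe a transformer encoder. -/
def TE.WellFormed (T : TE) : Prop :=
  T.layers ≠ [] ∧ EncoderFits 5 T.layers T.out

/-! ### Evaluation in a fixed-point arithmetic

All parameters are rounded to the arithmetic, and so is the result of every operation. -/

/-- `relu x = max 0 x`; no rounding is necessary, since `0` is representable. -/
def relu (x : ℚ) : ℚ := max 0 x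

/-- The values of parameters in `F`. -/
def params (F : FixedPoint) (l : List Param) : List ℚ := l.map fun p => F.rnd p.val

/-- Matrix-vector product. -/
def Mat.apply (F : FixedPoint) (M : Mat) (x : List ℚ) : List ℚ :=
  M.map fun r => F.dot (params F r) x

/-- The value `b + ∑ i, w i * x i` of a neuron before the activation. -/
def Neuron.affine (F : FixedPoint) (v : Neuron) (x : List ℚ) : ℚ :=
  F.add (F.rnd (Param.val v.1)) (F.dot (params F v.2) x)

def FNN.eval (F : FixedPoint) (N : FNN) (x : List ℚ) : List ℚ :=
  N.output.map fun v => Neuron.affine F v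
    (N.hidden.foldl (fun y l => l.map fun u => relu (Neuron.affine F u y)) x)

/-- The value of a network with a one-dimensional output. -/
def FNN.eval₁ (F : FixedPoint) (N : FNN) (x : List ℚ) : ℚ := (N.eval F x).headD 0

/-- The list of the values `hardmax (i, s_1, …, s_n)`, `i = 1, …, n`: it is `1 / m` if `s_i` is a
maximum and is attained at `m` positions, and `0` if `s_i` is not a maximum. -/
def hardmax (F : FixedPoint) (s : List ℚ) : List ℚ :=
  s.map fun x => if ∀ y ∈ s, y ≤ x then F.rnd (1 / (s.count x : ℚ)) else 0

def Head.score (F : FixedPoint) (A : Head) (x y : List ℚ) : ℚ :=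
  A.N.eval₁ F [F.dot (A.Q.apply F x) (A.K.apply F y)]

/-- The vector `∑ i, norm (i, s_1, …, s_n) • (W x_i)`. -/
def Head.pool (F : FixedPoint) (A : Head) (xs : List (List ℚ)) (s : List ℚ) : List ℚ :=
  A.W.map fun r =>
    F.sum (List.zipWith (fun a x => F.mul a (F.dot (params F r) x)) (hardmax F s) xs)

/-- The output of the attention head at a position with vector `x` of the sequence `xs`. -/
def Head.attend (F : FixedPoint) (A : Head) (xs : List (List ℚ)) (x : List ℚ) : List ℚ :=
  A.pool F xs (xs.map (A.score F x))

/-- An encoder layer maps a sequence of vectors to a sequence of vectors of the same length; the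
input of the combination is the old vector followed by the outputs of the heads. -/
def Layer.eval (F : FixedPoint) (l : Layer) (xs : List (List ℚ)) : List (List ℚ) :=
  xs.map fun x => l.comb.eval F (x ++ (l.heads.map fun A => A.attend F xs x).flatten)

/-- The embedding of the symbol `a_k` at position `i`, where `start` is the first position:
`(1, 1, i, ∑ j ≤ i, j, k)` if `i` is the first position and `(0, 1, i, ∑ j ≤ i, j, k)`
otherwise. -/
def embed (start k i : ℕ) : List ℚ :=
  [if i = start then 1 else 0, 1, i, ∑ j ∈ Finset.range (i + 1), (j : ℚ), k]

/-- The embedding of a word; its positions are `start, start + 1, …`. -/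
def embedWord (F : FixedPoint) (start : ℕ) {s : ℕ} (w : List (Fin s)) : List (List ℚ) :=
  w.mapIdx fun t a => (embed start (a.val + 1) (start + t)).map F.rnd

/-- The output `T w`, computed in `F`: the value of the output function at the last position. -/
def TE.eval (F : FixedPoint) (start : ℕ) (T : TE) (w : List (Fin T.alphabetSize)) : ℚ :=
  T.out.eval₁ F ((T.layers.foldl (fun xs l => l.eval F xs) (embedWord F start w)).getLastD [])

/-- Some non-empty word `w` is accepted by `T`, where the computation `T w` is carried out in the
arithmetic of the family `F` for the parameter `max |Σ| |w|`. -/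
def TE.Satisfiable (start : ℕ) (T : TE) (F : LogPrecision) : Prop :=
  ∃ w : List (Fin T.alphabetSize), w ≠ [] ∧
    T.eval (F.at (max T.alphabetSize w.length)) start w = 1

/-! ## Decision problems -/

/-- The decision problem "given `a ∈ C`, decide whether `P a`" is decidable. The behaviour of the
decision procedure on inputs outside of `C` is irrelevant. -/
def DecidableOn {α : Type} [Primcodable α] (C : Set α) (P : α → Prop) : Prop :=
  ∃ R : α → Prop, ComputablePred R ∧ ∀ a ∈ C, (R a ↔ P a)

/-! Finite descriptions as inputs of algorithms, through the evident bijections with products. -/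

def Rounding.equivFin : Rounding ≃ Fin 4 where
  toFun
    | .down => 0
    | .up => 1
    | .towardZero => 2
    | .nearest => 3
  invFun
    | 0 => .down
    | 1 => .up
    | 2 => .towardZero
    | 3 => .nearest
  left_inv x := by cases x <;> rfl
  right_inv x := by fin_cases x <;> rfl

def Overflow.equivBool : Overflow ≃ Bool where
  toFun
    | .saturate => false
    | .wrap => true
  invFun
    | false => .saturate
    | true => .wrap
  left_inv x := by cases x <;> rfl
  right_inv x := by cases x <;> rfl

def LogPrecision.equivProd : LogPrecision ≃ Rounding × Overflow × ℕ × ℕ × ℕ × ℕ where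
  toFun F := (F.rounding, F.overflow, F.intRate, F.intConst, F.fracRate, F.fracConst)
  invFun p := ⟨p.1, p.2.1, p.2.2.1, p.2.2.2.1, p.2.2.2.2.1, p.2.2.2.2.2⟩
  left_inv _ := rfl
  right_inv _ := rfl

def FNN.equivProd : FNN ≃ List (List Neuron) × List Neuron where
  toFun N := (N.hidden, N.output)
  invFun p := ⟨p.1, p.2⟩
  left_inv _ := rfl
  right_inv _ := rfl

def Head.equivProd : Head ≃ Mat × Mat × FNN × Mat where
  toFun A := (A.Q, A.K, A.N, A.W)
  invFun p := ⟨p.1, p.2.1, p.2.2.1, p.2.2.2⟩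
  left_inv _ := rfl
  right_inv _ := rfl

def Layer.equivProd : Layer ≃ List Head × FNN where
  toFun l := (l.heads, l.comb)
  invFun p := ⟨p.1, p.2⟩
  left_inv _ := rfl
  right_inv _ := rfl

def TE.equivProd : TE ≃ ℕ × List Layer × FNN where
  toFun T := (T.alphabetSize, T.layers, T.out)
  invFun p := ⟨p.1, p.2.1, p.2.2⟩
  left_inv _ := rfl
  right_inv _ := rfl

instance : Primcodable Rounding := Primcodable.ofEquiv _ Rounding.equivFin
instance : Primcodable Overflow := Primcodable.ofEquiv _ Overflow.equivBool
instance : Primcodable LogPrecision := Primcodable.ofEquiv _ LogPrecision.equivProd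
instance : Primcodable FNN := Primcodable.ofEquiv _ FNN.equivProd
instance : Primcodable Head := Primcodable.ofEquiv _ Head.equivProd
instance : Primcodable Layer := Primcodable.ofEquiv _ Layer.equivProd
instance : Primcodable TE := Primcodable.ofEquiv _ TE.equivProd

end TransformerSat

namespace TransformerSat

/-! ## Exactness of fixed-point arithmetic on grid points -/

/-! The halting problem is reduced to satisfiability. The intermediate notion is a `System`:
finitely many rows, each of which adds up integer contributions of the letters along a word and
demands that the running total be nonnegative at those positions whose letter does not close the
row.

Such systems can simulate programs. A run of a nondeterministic register program is a word over the
transitions of a finite automaton. The totals hold linear forms in the registers, so decrements and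
linear zero tests are inequalities. One more total follows the state number and forces consecutive
transitions to fit together. Programs are closed under sequence, choice and iteration
(`Realizable`), guessing and testing gives existential quantifiers and bounded loops
(`Definable.ex`, `Definable.iter`), and induction over the partial recursive functions makes all
their graphs definable (`definableGraph`). The universal function yields one fixed system that is
undecidable in its input `n` (`exists_undecidable_system`).

Conversely, three encoder layers check a system (`encoder_satisfiable`). The first looks up the
contributions of the letter. The second averages them over the prefix by a hardmax that is uniform
on the positions up to the current one; an average has the sign of the sum, so a relu measures the
violation. The third averages the violations over the whole word, so that the last position sees
whether any occurred.

Rounding does no harm. All parameters are integers, and the only inexact results are the rounded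
weights `1 / r` and the products with such a weight in the last averaging. A weight `1 / r` is
rounded to one positive grid point common to all positions that share it, which preserves signs, and
the last products are too large to be rounded to zero. The input `n` appears as a weight; the
alphabet is enlarged in proportion to `n + 1`, so that the precision suffices even for short words.
-/

/-- Integer bounds survive all four rounding modes. This is the only property of rounding on which
the rest depends. -/
theorem Rounding.toInt_mem (R : Rounding) {x : ℚ} {a b : ℤ} (ha : (a : ℚ) ≤ x) (hb : x ≤ b) :
    a ≤ R.toInt x ∧ R.toInt x ≤ b := by
  have h1 : a ≤ ⌊x⌋ := Int.le_floor.2 ha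
  have h2 : ⌈x⌉ ≤ b := Int.ceil_le.2 hb
  have h3 : ⌊x⌋ ≤ ⌈x⌉ := Int.floor_le_ceil x
  cases R
  · exact ⟨h1, h3.trans h2⟩
  · exact ⟨h1.trans h3, h2⟩
  · simp only [Rounding.toInt]
    split_ifs
    · exact ⟨h1, h3.trans h2⟩
    · exact ⟨h1.trans h3, h2⟩
  · simp only [Rounding.toInt, round_eq]
    refine ⟨Int.le_floor.2 (by linarith), Int.lt_add_one_iff.1 (Int.floor_lt.2 ?_)⟩
    push_cast
    linarith

theorem Overflow.reduce_eq (O : Overflow) {M : ℕ} {k : ℤ} (h1 : -(M : ℤ) ≤ k) (h2 : k < M) :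
    O.reduce M k = k := by
  cases O
  · simp only [Overflow.reduce]
    omega
  · simp only [Overflow.reduce]
    apply Int.bmod_eq_of_le <;> omega

namespace FixedPoint

variable {F : FixedPoint}

/-- The integer multiples of the precision of `F`. -/
def Grid (F : FixedPoint) (x : ℚ) : Prop := ∃ k : ℤ, x = k / 2 ^ F.fracBits

theorem Grid.int (k : ℤ) : F.Grid k := ⟨k * 2 ^ F.fracBits, by push_cast; field_simp⟩

theorem Grid.zero : F.Grid 0 := by simpa using Grid.int (F := F) 0

theorem Grid.add {x y : ℚ} (hx : F.Grid x) (hy : F.Grid y) : F.Grid (x + y) := by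
  obtain ⟨k, rfl⟩ := hx
  obtain ⟨l, rfl⟩ := hy
  exact ⟨k + l, by push_cast; ring⟩

theorem Grid.int_mul {x : ℚ} (k : ℤ) (hx : F.Grid x) : F.Grid (k * x) := by
  obtain ⟨l, rfl⟩ := hx
  exact ⟨k * l, by push_cast; ring⟩

theorem Grid.relu {x : ℚ} (hx : F.Grid x) : F.Grid (relu x) := by
  unfold TransformerSat.relu
  rcases max_choice 0 x with h | h <;> rw [h]
  exacts [Grid.zero, hx]

theorem Grid.sum {ι : Type*} {s : Finset ι} {f : ι → ℚ} (h : ∀ i ∈ s, F.Grid (f i)) :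
    F.Grid (∑ i ∈ s, f i) :=
  Finset.sum_induction f F.Grid (fun _ _ => Grid.add) Grid.zero h

theorem Grid.rnd (x : ℚ) : F.Grid (F.rnd x) := ⟨_, rfl⟩

/-- Bounds that are grid points survive rounding, because both reduce to integers after scaling and
no overflow can occur between them. With `a = x = b` this is exactness; with `a < b` it controls the
inexact results. -/
theorem rnd_mem {a b x : ℚ} (ha : F.Grid a) (hb : F.Grid b) (hax : a ≤ x) (hxb : x ≤ b)
    (ha' : |a| < 2 ^ F.intBits) (hb' : |b| < 2 ^ F.intBits) : a ≤ F.rnd x ∧ F.rnd x ≤ b := by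
  obtain ⟨k, rfl⟩ := ha
  obtain ⟨l, rfl⟩ := hb
  have hp : (0 : ℚ) < 2 ^ F.fracBits := by positivity
  have hM : (((2 ^ (F.intBits + F.fracBits) : ℕ) : ℤ) : ℚ) = 2 ^ F.intBits * 2 ^ F.fracBits := by
    push_cast
    rw [pow_add]
  obtain ⟨h1, h2⟩ := F.rounding.toInt_mem ((div_le_iff₀ hp).1 hax) ((le_div_iff₀ hp).1 hxb)
  rw [abs_lt, lt_div_iff₀ hp, neg_mul] at ha'
  rw [abs_lt, div_lt_iff₀ hp] at hb'
  have h3 : -((2 ^ (F.intBits + F.fracBits) : ℕ) : ℤ) < k := by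
    rw [← Int.cast_lt (R := ℚ), Int.cast_neg, hM]
    exact ha'.1
  have h4 : l < ((2 ^ (F.intBits + F.fracBits) : ℕ) : ℤ) := by
    rw [← Int.cast_lt (R := ℚ), hM]
    exact hb'.2
  unfold FixedPoint.rnd
  rw [F.overflow.reduce_eq (by omega) (by omega)]
  constructor <;> gcongr

theorem rnd_eq {x : ℚ} (hx : F.Grid x) (h : |x| < 2 ^ F.intBits) : F.rnd x = x :=
  let ⟨h1, h2⟩ := rnd_mem hx hx le_rfl le_rfl h h
  le_antisymm h2 h1

theorem foldl_add_eq (l : List ℚ) : ∀ a : ℚ, F.Grid a → (∀ x ∈ l, F.Grid x) →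
    |a| + (l.map abs).sum < 2 ^ F.intBits → l.foldl F.add a = a + l.sum := by
  induction l with
  | nil => intro a _ _ _; simp
  | cons x l ih =>
    intro a ha hl hb
    have hx := hl x (by simp)
    have h0 : 0 ≤ (l.map abs).sum := List.sum_nonneg (by simp)
    have h1 := abs_add_le a x
    simp only [List.map_cons, List.sum_cons] at hb
    have h2 : F.add a x = a + x := rnd_eq (ha.add hx) (by linarith)
    rw [List.foldl_cons, h2, ih _ (ha.add hx) (fun y hy => hl y (by simp [hy])) (by linarith),
      List.sum_cons]
    ring

theorem _root_.List.sum_map_range_eq {M : Type*} [AddCommMonoid M] (n : ℕ) (f : ℕ → M) :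
    ((List.range n).map f).sum = ∑ i ∈ Finset.range n, f i := by
  induction n with
  | zero => simp
  | succ n ih => simp [List.range_succ, Finset.sum_range_succ, ih]

theorem sum_range_eq {n : ℕ} {f : ℕ → ℚ} {B : ℚ} (hg : ∀ i < n, F.Grid (f i))
    (hB : ∀ i < n, |f i| ≤ B) (h : n * B < 2 ^ F.intBits) :
    F.sum ((List.range n).map f) = ∑ i ∈ Finset.range n, f i := by
  unfold FixedPoint.sum
  rw [foldl_add_eq _ _ Grid.zero, List.sum_map_range_eq, zero_add]
  · intro x hx
    obtain ⟨i, hi, rfl⟩ := List.mem_map.1 hx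
    exact hg i (List.mem_range.1 hi)
  · rw [List.map_map, List.sum_map_range_eq, abs_zero, zero_add]
    refine lt_of_le_of_lt (Finset.sum_le_card_nsmul _ _ B ?_) (by simpa using h)
    intro i hi
    exact hB i (Finset.mem_range.1 hi)

end FixedPoint

/-! ## Networks with integer parameters -/

/-- An integer parameter. -/
def intParam (z : ℤ) : Param := (z, 0)

/-- A list of integer weights. -/
def weights (d : ℕ) (w : ℕ → ℤ) : List Param := (List.range d).map fun j => intParam (w j)

/-- The neuron with bias `b` and weights `w 0, …, w (d - 1)`. -/
def neuron (d : ℕ) (b : ℤ) (w : ℕ → ℤ) : Neuron := (intParam b, weights d w)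

/-- The arithmetic `F` has at least `c * log X` bits on both sides of the point. -/
structure Wide (F : FixedPoint) (X c : ℕ) : Prop where
  two_le : 2 ≤ X
  int : X ^ c ≤ 2 ^ F.intBits
  frac : X ∣ 2 ^ F.fracBits
  sq_frac : X ^ 2 ≤ 2 ^ F.fracBits

/-- A grid point that is at most `X ^ k` in absolute value. -/
def Small (F : FixedPoint) (X k : ℕ) (x : ℚ) : Prop := F.Grid x ∧ |x| ≤ (X : ℚ) ^ k

variable {F : FixedPoint} {X c : ℕ}

theorem Wide.one_le (h : Wide F X c) : (1 : ℚ) ≤ X := by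
  have := h.two_le
  exact_mod_cast (by omega : 1 ≤ X)

theorem Wide.lt (h : Wide F X c) {k : ℕ} (hk : k < c) : (X : ℚ) ^ k < 2 ^ F.intBits := by
  have h1 : (X : ℚ) ^ c ≤ 2 ^ F.intBits := by exact_mod_cast h.int
  refine lt_of_lt_of_le (pow_lt_pow_right₀ ?_ hk) h1
  have := h.two_le
  exact_mod_cast (by omega : 1 < X)

theorem Small.mono (h : Wide F X c) {k l : ℕ} (hkl : k ≤ l) {x : ℚ} (hx : Small F X k x) :
    Small F X l x :=
  ⟨hx.1, hx.2.trans (pow_le_pow_right₀ h.one_le hkl)⟩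

theorem Small.rnd_eq (h : Wide F X c) {k : ℕ} (hk : k < c) {x : ℚ} (hx : Small F X k x) :
    F.rnd x = x :=
  FixedPoint.rnd_eq hx.1 (hx.2.trans_lt (h.lt hk))

theorem Small.int {z : ℤ} {k : ℕ} (hz : |z| ≤ (X : ℤ) ^ k) : Small F X k z :=
  ⟨.int z, by exact_mod_cast hz⟩

theorem Small.nat {z : ℕ} {k : ℕ} (hz : z ≤ X ^ k) : Small F X k z :=
  ⟨by simpa using FixedPoint.Grid.int (F := F) z, by rw [Nat.abs_cast]; exact_mod_cast hz⟩

theorem Small.relu {k : ℕ} {x : ℚ} (hx : Small F X k x) : Small F X k (relu x) := by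
  refine ⟨hx.1.relu, le_trans ?_ hx.2⟩
  unfold TransformerSat.relu
  rw [abs_of_nonneg (le_max_left _ _)]
  exact max_le (abs_nonneg _) (le_abs_self _)

theorem Small.int_mul {i k : ℕ} {x : ℚ} {z : ℤ} (hz : |z| ≤ (X : ℤ) ^ i) (hx : Small F X k x) :
    Small F X (i + k) (z * x) := by
  refine ⟨hx.1.int_mul z, ?_⟩
  rw [abs_mul, pow_add]
  have : |(z : ℚ)| ≤ (X : ℚ) ^ i := by exact_mod_cast hz
  exact mul_le_mul this hx.2 (abs_nonneg _) (by positivity)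

/-- Sizes are tracked by exponents of `X`: an addition costs one exponent because `2 ≤ X`, a sum of
at most `X` terms costs one as well, and exponents add up in products. The encoder has constant
depth, so a constant exponent bounds all its values. -/
theorem Small.add (h : Wide F X c) {k : ℕ} {x y : ℚ} (hx : Small F X k x) (hy : Small F X k y) :
    Small F X (k + 1) (x + y) := by
  refine ⟨hx.1.add hy.1, (abs_add_le _ _).trans ?_⟩
  have h2 : (2 : ℚ) ≤ X := by exact_mod_cast h.two_le
  have : (0 : ℚ) ≤ (X : ℚ) ^ k := by positivity
  rw [pow_succ]
  nlinarith [hx.2, hy.2]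

theorem Small.sum {k d : ℕ} (hd : d ≤ X) {f : ℕ → ℚ} (hf : ∀ i < d, Small F X k (f i)) :
    Small F X (k + 1) (∑ i ∈ Finset.range d, f i) := by
  refine ⟨.sum fun i hi => (hf i (Finset.mem_range.1 hi)).1, ?_⟩
  refine (Finset.abs_sum_le_sum_abs _ _).trans
    ((Finset.sum_le_card_nsmul _ _ _ fun i hi => (hf i (Finset.mem_range.1 hi)).2).trans ?_)
  rw [Finset.card_range, nsmul_eq_mul, pow_succ, mul_comm]
  gcongr

theorem Small.fsum_eq (h : Wide F X c) {k d : ℕ} (hk : k + 1 < c) (hd : d ≤ X) {f : ℕ → ℚ}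
    (hf : ∀ i < d, Small F X k (f i)) :
    F.sum ((List.range d).map f) = ∑ i ∈ Finset.range d, f i := by
  refine FixedPoint.sum_range_eq (fun i hi => (hf i hi).1) (fun i hi => (hf i hi).2)
    (lt_of_le_of_lt ?_ (h.lt hk))
  rw [pow_succ, mul_comm]
  gcongr

theorem _root_.List.zipWith_map_same {α β γ δ : Type*} (g : β → γ → δ) (f₁ : α → β) (f₂ : α → γ)
    (l : List α) : List.zipWith g (l.map f₁) (l.map f₂) = l.map fun a => g (f₁ a) (f₂ a) := by
  induction l with
  | nil => rfl
  | cons a l ih => simp [ih]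

theorem dot_eq (h : Wide F X c) {i k d : ℕ} (hk : i + k + 1 < c) (hd : d ≤ X) {a : ℕ → ℤ}
    {f : ℕ → ℚ} (ha : ∀ j < d, |a j| ≤ (X : ℤ) ^ i) (hf : ∀ j < d, Small F X k (f j)) :
    F.dot ((List.range d).map fun j => (a j : ℚ)) ((List.range d).map f) =
      ∑ j ∈ Finset.range d, a j * f j := by
  have hs : ∀ j < d, Small F X (i + k) (a j * f j) := fun j hj => (hf j hj).int_mul (ha j hj)
  unfold FixedPoint.dot
  rw [List.zipWith_map_same, ← Small.fsum_eq h hk hd hs]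
  congr 1
  refine List.map_congr_left fun j hj => ?_
  exact (hs j (List.mem_range.1 hj)).rnd_eq h (by omega)

theorem rnd_intParam (h : Wide F X c) (hc : 1 < c) {z : ℤ} (hz : |z| ≤ X) :
    F.rnd (intParam z).val = z := by
  have : (intParam z).val = z := by simp [intParam, Param.val]
  rw [this]
  exact (Small.int (k := 1) (by simpa using hz)).rnd_eq h hc

theorem params_weights (h : Wide F X c) (hc : 1 < c) {d : ℕ} {w : ℕ → ℤ}
    (hw : ∀ j < d, |w j| ≤ X) : params F (weights d w) = (List.range d).map fun j => (w j : ℚ) := by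
  unfold params weights
  rw [List.map_map]
  exact List.map_congr_left fun j hj => rnd_intParam h hc (hw j (List.mem_range.1 hj))

theorem dot_weights (h : Wide F X c) {k d : ℕ} (hk : k + 2 < c) (hd : d ≤ X) {w : ℕ → ℤ}
    {f : ℕ → ℚ} (hw : ∀ j < d, |w j| ≤ X) (hf : ∀ j < d, Small F X k (f j)) :
    F.dot (params F (weights d w)) ((List.range d).map f) = ∑ j ∈ Finset.range d, w j * f j := by
  rw [params_weights h (by omega) hw]
  exact dot_eq h (i := 1) (by omega) hd (by simpa using hw) hf

theorem affine_neuron (h : Wide F X c) {k d : ℕ} (hk : k + 3 < c) (hd : d ≤ X) {b : ℤ}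
    {w : ℕ → ℤ} {f : ℕ → ℚ} (hb : |b| ≤ X) (hw : ∀ j < d, |w j| ≤ X)
    (hf : ∀ j < d, Small F X k (f j)) :
    Neuron.affine F (neuron d b w) ((List.range d).map f) =
      b + ∑ j ∈ Finset.range d, w j * f j ∧
    Small F X (k + 3) (b + ∑ j ∈ Finset.range d, w j * f j) := by
  have hs : Small F X (k + 3) (b + ∑ j ∈ Finset.range d, w j * f j) := by
    refine Small.add h (Small.mono h (k := 1) (by omega) (Small.int (by simpa using hb))) ?_
    refine Small.sum (k := k + 1) hd fun j hj => ?_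
    have := (hf j hj).int_mul (i := 1) (z := w j) (by simpa using hw j hj)
    rwa [add_comm] at this
  refine ⟨?_, hs⟩
  unfold Neuron.affine neuron FixedPoint.add
  simp only
  rw [rnd_intParam h (by omega) hb, dot_weights h (by omega) hd hw hf, hs.rnd_eq h hk]

/-- The network with one hidden layer of `h` neurons and with `o` outputs on `d` inputs. -/
def oneHidden (d h o : ℕ) (b : ℕ → ℤ) (w : ℕ → ℕ → ℤ) (b' : ℕ → ℤ) (w' : ℕ → ℕ → ℤ) : FNN where
  hidden := [(List.range h).map fun i => neuron d (b i) (w i)]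
  output := (List.range o).map fun i => neuron h (b' i) (w' i)

theorem eval_oneHidden (hX : Wide F X c) {k d h o : ℕ} (hk : k + 6 < c) (hd : d ≤ X) (hh : h ≤ X)
    {b : ℕ → ℤ} {w : ℕ → ℕ → ℤ} {b' : ℕ → ℤ} {w' : ℕ → ℕ → ℤ} {f : ℕ → ℚ}
    (hb : ∀ i < h, |b i| ≤ X) (hw : ∀ i < h, ∀ j < d, |w i j| ≤ X)
    (hb' : ∀ i < o, |b' i| ≤ X) (hw' : ∀ i < o, ∀ j < h, |w' i j| ≤ X)
    (hf : ∀ j < d, Small F X k (f j)) :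
    (oneHidden d h o b w b' w').eval F ((List.range d).map f) =
      (List.range o).map fun i => b' i + ∑ j ∈ Finset.range h,
        w' i j * relu (b j + ∑ l ∈ Finset.range d, w j l * f l) := by
  have h1 : ((List.range h).map fun i => neuron d (b i) (w i)).map
      (fun u => relu (Neuron.affine F u ((List.range d).map f))) =
      (List.range h).map fun j => relu (b j + ∑ l ∈ Finset.range d, w j l * f l) := by
    rw [List.map_map]
    refine List.map_congr_left fun j hj => ?_
    have hj := List.mem_range.1 hj
    simp only [Function.comp]
    rw [(affine_neuron hX (by omega) hd (hb j hj) (hw j hj) hf).1]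
  unfold FNN.eval oneHidden
  simp only [List.foldl_cons, List.foldl_nil]
  rw [h1, List.map_map]
  refine List.map_congr_left fun i hi => ?_
  have hi := List.mem_range.1 hi
  simp only [Function.comp]
  refine (affine_neuron hX (k := k + 3) (by omega) hh (hb' i hi) (hw' i hi) fun j hj => ?_).1
  exact (affine_neuron hX (by omega) hd (hb j hj) (hw j hj) hf).2.relu

theorem hasDims_oneHidden (d h o : ℕ) (b : ℕ → ℤ) (w : ℕ → ℕ → ℤ) (b' : ℕ → ℤ)
    (w' : ℕ → ℕ → ℤ) : (oneHidden d h o b w b' w').HasDims d o := by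
  simp [FNN.HasDims, oneHidden, LayersFit, NeuronsFit, neuron, weights]

/-- The affine map with one output. -/
def flat (d : ℕ) (b : ℤ) (w : ℕ → ℤ) : FNN := ⟨[], [neuron d b w]⟩

theorem eval_flat (hX : Wide F X c) {k d : ℕ} (hk : k + 3 < c) (hd : d ≤ X) {b : ℤ}
    {w : ℕ → ℤ} {f : ℕ → ℚ} (hb : |b| ≤ X) (hw : ∀ j < d, |w j| ≤ X)
    (hf : ∀ j < d, Small F X k (f j)) :
    (flat d b w).eval F ((List.range d).map f) = [b + ∑ j ∈ Finset.range d, w j * f j] := by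
  simp [FNN.eval, flat, (affine_neuron hX hk hd hb hw hf).1]

theorem hasDims_flat (d : ℕ) (b : ℤ) (w : ℕ → ℤ) : (flat d b w).HasDims d 1 := by
  simp [FNN.HasDims, flat, LayersFit, NeuronsFit, neuron, weights]

/-- The coordinate `i`. -/
def unit (i : ℕ) (z : ℤ) (j : ℕ) : ℤ := if j = i then z else 0

theorem sum_unit {d i : ℕ} (hi : i < d) (z : ℤ) (f : ℕ → ℚ) :
    ∑ j ∈ Finset.range d, (unit i z j : ℚ) * f j = z * f i := by
  simp only [unit]
  push_cast
  simp [ite_mul, Finset.sum_ite_eq', hi]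

theorem abs_unit_le {i : ℕ} {z : ℤ} {B : ℕ} (hz : |z| ≤ B) (j : ℕ) : |unit i z j| ≤ B := by
  unfold unit
  split_ifs
  · exact hz
  · simp

theorem apply_weights (hX : Wide F X c) {k d e : ℕ} (hk : k + 2 < c) (hd : d ≤ X)
    {w : ℕ → ℕ → ℤ} {f : ℕ → ℚ} (hw : ∀ i < e, ∀ j < d, |w i j| ≤ X)
    (hf : ∀ j < d, Small F X k (f j)) :
    Mat.apply F ((List.range e).map fun i => weights d (w i)) ((List.range d).map f) =
      (List.range e).map fun i => ∑ j ∈ Finset.range d, w i j * f j := by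
  unfold Mat.apply
  rw [List.map_map]
  refine List.map_congr_left fun i hi => ?_
  exact dot_weights hX hk hd (hw i (List.mem_range.1 hi)) hf

/-! ## Averages -/

/-- The value of `1 / r` in `F`. -/
def recip (F : FixedPoint) (r : ℕ) : ℚ := F.rnd (1 / (r : ℚ))

/-- Since `X` divides `2 ^ F.fracBits`, its inverse is representable. It serves as a positive lower
bound that rounding cannot destroy. -/
theorem grid_inv (h : Wide F X c) : F.Grid (1 / (X : ℚ)) := by
  obtain ⟨k, hk⟩ := h.frac
  have := h.two_le
  have h0 : (X : ℚ) ≠ 0 := by positivity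
  have h1 : (2 : ℚ) ^ F.fracBits = X * k := by exact_mod_cast hk
  refine ⟨k, ?_⟩
  have h2 : (k : ℚ) ≠ 0 := by
    rintro h
    rw [h, mul_zero] at h1
    exact absurd h1 (by positivity)
  rw [h1]
  push_cast
  field_simp

theorem recip_mem (h : Wide F X c) (hc : 0 < c) {r : ℕ} (h1 : 1 ≤ r) (hr : r ≤ X) :
    F.Grid (recip F r) ∧ 1 / (X : ℚ) ≤ recip F r ∧ recip F r ≤ 1 := by
  have hX := h.one_le
  have h1' : (1 : ℚ) ≤ r := by exact_mod_cast h1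
  have hr' : (r : ℚ) ≤ X := by exact_mod_cast hr
  have hI : (1 : ℚ) < 2 ^ F.intBits := by simpa using h.lt hc
  refine ⟨.rnd _, ?_⟩
  refine FixedPoint.rnd_mem (grid_inv h) (by simpa using FixedPoint.Grid.int (F := F) 1) ?_ ?_ ?_ ?_
  · exact one_div_le_one_div_of_le (by linarith) hr'
  · exact (div_le_one (by linarith)).2 h1'
  · rw [abs_of_nonneg (by positivity)]
    exact lt_of_le_of_lt ((div_le_one (by linarith)).2 hX) hI
  · simpa using hI

/-- Rounding changes `1 / r` by at most one grid step, and `r ≤ X ≤ 2 ^ F.fracBits`, so the total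
weight exceeds `1` by at most `1`. This bounds prefix averages independently of the length of the
prefix. -/
theorem mul_recip_le (h : Wide F X c) (hc : 1 < c) {r : ℕ} (h1 : 1 ≤ r) (hr : r ≤ X) :
    r * recip F r ≤ 2 := by
  have hX := h.one_le
  have h1' : (1 : ℚ) ≤ r := by exact_mod_cast h1
  have hr' : (r : ℚ) ≤ X := by exact_mod_cast hr
  have hp : (0 : ℚ) < 2 ^ F.fracBits := by positivity
  have hp1 : (1 : ℚ) ≤ 2 ^ F.fracBits := one_le_pow₀ (by norm_num)
  have hI : (X : ℚ) < 2 ^ F.intBits := by simpa using h.lt hc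
  have hXf : (X : ℚ) ≤ 2 ^ F.fracBits := by
    have : X ≤ 2 ^ F.fracBits := Nat.le_of_dvd (by positivity) h.frac
    exact_mod_cast this
  have hfl := Int.lt_floor_add_one (1 / (r : ℚ) * 2 ^ F.fracBits)
  have hfl' := Int.floor_le (1 / (r : ℚ) * 2 ^ F.fracBits)
  set k := ⌊1 / (r : ℚ) * 2 ^ F.fracBits⌋
  have hk0 : (0 : ℚ) ≤ k := by exact_mod_cast Int.floor_nonneg.2 (by positivity)
  have hle : ((k : ℚ) + 1) / 2 ^ F.fracBits ≤ 1 / r + 1 / 2 ^ F.fracBits := by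
    rw [add_div]
    exact add_le_add ((div_le_iff₀ hp).2 hfl') le_rfl
  have h11 : 1 / (r : ℚ) ≤ 1 := (div_le_one (by linarith)).2 h1'
  have h12 : 1 / (2 : ℚ) ^ F.fracBits ≤ 1 := (div_le_one hp).2 hp1
  by_cases hr1 : r = 1
  · have := (recip_mem h (by omega) h1 hr).2.2
    subst hr1
    push_cast
    linarith
  have hX2 : (2 : ℚ) ≤ X := by exact_mod_cast h.two_le
  have hub : recip F r ≤ ((k : ℚ) + 1) / 2 ^ F.fracBits := by
    refine (FixedPoint.rnd_mem (F := F) (a := 0) (x := 1 / (r : ℚ))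
      FixedPoint.Grid.zero ⟨k + 1, by push_cast; rfl⟩
      (by positivity) ?_ ?_ ?_).2
    · exact (le_div_iff₀ hp).2 hfl.le
    · simp
    · rw [abs_of_nonneg (by positivity)]
      have h1r : 1 / (r : ℚ) ≤ 1 / 2 := by
        apply one_div_le_one_div_of_le (by norm_num)
        exact_mod_cast (by omega : 2 ≤ r)
      linarith
  calc r * recip F r ≤ r * (1 / r + 1 / 2 ^ F.fracBits) := by gcongr; linarith
    _ = 1 + r / 2 ^ F.fracBits := by field_simp
    _ ≤ 2 := by
      have : (r : ℚ) / 2 ^ F.fracBits ≤ 1 := (div_le_one hp).2 (hr'.trans hXf)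
      linarith

theorem hardmax_map (F : FixedPoint) (n : ℕ) (s : ℕ → ℚ) (M : ℚ) (hM : ∀ i < n, s i ≤ M)
    (hM' : ∃ i < n, s i = M) :
    hardmax F ((List.range n).map s) = (List.range n).map fun i =>
      if s i = M then recip F ((List.range n).countP fun j => s j = M) else 0 := by
  unfold hardmax
  rw [List.map_map]
  refine List.map_congr_left fun i hi => ?_
  have hi := List.mem_range.1 hi
  obtain ⟨l, hl, hlM⟩ := hM'
  have hiff : (∀ y ∈ (List.range n).map s, y ≤ s i) ↔ s i = M := by
    constructor
    · intro h
      exact le_antisymm (hM i hi) (hlM ▸ h (s l) (List.mem_map_of_mem (List.mem_range.2 hl)))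
    · rintro h y hy
      obtain ⟨j, hj, rfl⟩ := List.mem_map.1 hy
      rw [h]
      exact hM j (List.mem_range.1 hj)
  simp only [Function.comp, hiff]
  split_ifs with h
  · unfold recip
    rw [h, List.count, List.countP_map]
    congr 4
  · rfl

theorem pool_eq (F : FixedPoint) (A : Head) (n : ℕ) (xs : ℕ → List ℚ) (s : ℕ → ℚ) (M : ℚ)
    (hM : ∀ i < n, s i ≤ M) (hM' : ∃ i < n, s i = M) :
    A.pool F ((List.range n).map xs) ((List.range n).map s) =
      A.W.map fun r => F.sum ((List.range n).map fun i =>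
        F.mul (if s i = M then recip F ((List.range n).countP fun j => s j = M) else 0)
          (F.dot (params F r) (xs i))) := by
  unfold Head.pool
  rw [hardmax_map F n s M hM hM']
  simp only [List.zipWith_map_same]

/-! ### Systems of prefix inequalities and the layer that looks up letters -/

/-- A system of inequalities on the prefixes of words over the letters `0, …, J`. Row `r` of the
system demands that `init r + n * coeff r + ∑ i ≤ m, step r (a i)` is nonnegative at all positions
`m` with a letter at which the row is not closed; here `n` is an input. -/
structure System where
  J : ℕ
  R : ℕ
  D : ℕ
  step : ℕ → ℕ → ℤ
  closed : ℕ → ℕ → Bool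
  init : ℕ → ℤ
  coeff : ℕ → ℤ
  bad : ℕ → Bool
  step_le : ∀ r a, |step r a| ≤ D
  init_le : ∀ r, |init r| ≤ D
  coeff_le : ∀ r, |coeff r| ≤ D

namespace System

variable (S : System)

/-- The left-hand side of row `r` after the letters at the positions `0, …, m`. -/
def value (n : ℕ) (a : ℕ → ℕ) (r m : ℕ) : ℤ :=
  S.init r + n * S.coeff r + ∑ i ∈ Finset.range (m + 1), S.step r (a i)

/-- The word `a 0, …, a (len - 1)` satisfies all inequalities and its last letter is not bad. -/
def Accepts (n len : ℕ) (a : ℕ → ℕ) : Prop :=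
  (∀ m < len, ∀ r < S.R, S.closed r (a m) = false → 0 ≤ S.value n a r m) ∧
    S.bad (a (len - 1)) = false

/-- The factor by which `n + 1` is to be multiplied in order to bound all parameters. -/
def size : ℕ := 5 + 4 * S.D + 2 * S.J + 3 * S.R

/-- The letter-dependent part of coordinate `o` after the first layer. -/
def table (o a : ℕ) : ℤ :=
  if o = 0 then 1 else if o = 1 then 0 else if o = 2 then (S.bad a).toInt else
    if o < 3 + S.R then S.step (o - 3) a else (S.closed (o - 3 - S.R) a).toInt

/-- The number of coordinates after the first layer. -/
def dim : ℕ := 3 + 2 * S.R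

/-- The hidden neurons 0, 1, 2 carry `n` times the first-position flag, the flag itself and the
position. They are followed by `J` neurons `relu (k - 1 - j)` and `J` neurons `relu (k - 2 - j)`,
where `k` is the index of the symbol; the difference of the two is a threshold indicator. -/
def inputBias (i : ℕ) : ℤ :=
  if i < 3 then 0 else if i < 3 + S.J then -1 - ((i - 3 : ℕ) : ℤ) else -2 - ((i - 3 - S.J : ℕ) : ℤ)

def inputWeight (n i : ℕ) : ℕ → ℤ :=
  if i = 0 then unit 0 n else if i = 1 then unit 0 1 else if i = 2 then unit 2 1 else unit 4 1

/-- The first two weights put `n * coeff + init` into the contribution of the first position, so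
that plain prefix sums yield `value`. The remaining ones are the increments of the table, with
opposite signs for the two families of threshold neurons. -/
def tableWeight (o j : ℕ) : ℤ :=
  if j = 0 then (if 3 ≤ o ∧ o < 3 + S.R then S.coeff (o - 3) else 0) else
  if j = 1 then (if 3 ≤ o ∧ o < 3 + S.R then S.init (o - 3) else 0) else
  if j = 2 then (if o = 1 then 1 else 0) else
  if j < 3 + S.J then S.table o (j - 3 + 1) - S.table o (j - 3) else
    S.table o (j - 3 - S.J) - S.table o (j - 3 - S.J + 1)

/-- The network that looks up the tables of the letter. -/
def lookup (n : ℕ) : FNN :=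
  oneHidden 5 (3 + (S.J + S.J)) S.dim S.inputBias (inputWeight n) (fun o => S.table o 0)
    S.tableWeight

/-- A head without output. -/
def idleHead : Head := ⟨[], [], flat 1 0 (fun _ => 0), []⟩

def lookupLayer (n : ℕ) : Layer := ⟨[idleHead], S.lookup n⟩

/-- Coordinate `o` after the first layer, at position `t` that carries the letter `a`. -/
def feature (start n a t o : ℕ) : ℤ :=
  S.table o (min a S.J) + S.tableWeight o 0 * (if t = 0 then n else 0) +
    S.tableWeight o 1 * (if t = 0 then 1 else 0) + S.tableWeight o 2 * (start + t : ℕ)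

/-- Table look-up by telescoping over thresholds. There are only `J` thresholds, which is why larger
letters act like `J`. -/
theorem sum_steps (τ : ℕ → ℤ) (J a : ℕ) :
    τ 0 + ∑ j ∈ Finset.range J, (τ (j + 1) - τ j) * (if j < a then 1 else 0) = τ (min a J) := by
  induction J with
  | zero => simp
  | succ J ih =>
    rw [Finset.sum_range_succ, ← add_assoc, ih]
    split_ifs with h
    · rw [min_eq_right h.le, min_eq_right (by omega : J + 1 ≤ a)]
      ring
    · rw [min_eq_left (by omega : a ≤ J), min_eq_left (by omega : a ≤ J + 1)]
      ring

theorem relu_sub_relu (a j : ℕ) :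
    relu ((-1 - (j : ℤ) : ℤ) + 1 * ((a + 1 : ℕ) : ℚ)) -
      relu ((-2 - (j : ℤ) : ℤ) + 1 * ((a + 1 : ℕ) : ℚ)) = if j < a then 1 else 0 := by
  unfold relu
  push_cast
  split_ifs with h
  · have : (j : ℚ) + 1 ≤ a := by exact_mod_cast h
    rw [max_eq_right (by linarith), max_eq_right (by linarith)]
    ring
  · have : (a : ℚ) ≤ j := by exact_mod_cast not_lt.1 h
    rw [max_eq_left (by linarith), max_eq_left (by linarith)]
    ring

theorem toInt_mem (b : Bool) : 0 ≤ b.toInt ∧ b.toInt ≤ 1 := by cases b <;> decide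

theorem abs_table_le (o a : ℕ) : |S.table o a| ≤ S.D + 1 := by
  have h1 := toInt_mem (S.bad a)
  have h2 := toInt_mem (S.closed (o - 3 - S.R) a)
  have h3 := S.step_le (o - 3) a
  unfold table
  split_ifs <;> rw [abs_le] at * <;> constructor <;> omega

theorem abs_tableWeight_le (o j : ℕ) : |S.tableWeight o j| ≤ 2 * S.D + 2 := by
  have h (o a b) : |S.table o a - S.table o b| ≤ 2 * S.D + 2 := by
    have h1 := S.abs_table_le o a
    have h2 := S.abs_table_le o b
    rw [abs_le] at *
    constructor <;> omega
  have h1 := S.coeff_le (o - 3)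
  have h2 := S.init_le (o - 3)
  unfold tableWeight
  split_ifs
  any_goals exact h _ _ _
  all_goals
    rw [abs_le] at *
    constructor <;> omega

/-- Input and parameters are integers bounded by powers of `X`, so the network is evaluated exactly
and only the telescoping identity remains. -/
theorem lookup_eval (hX : Wide F X c) (hc : 8 < c) {n : ℕ} (hn : S.size * (n + 1) ≤ X)
    {start a t : ℕ} (hs : start ≤ 1) (ha : a + 1 ≤ X) (ht : t + 1 ≤ X) :
    (S.lookup n).eval F ((embed start (a + 1) (start + t)).map F.rnd) =
      (List.range S.dim).map fun o => (S.feature start n a t o : ℚ) := by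
  have hX1 := hX.two_le
  have hsz : S.size ≤ X := le_trans (Nat.le_mul_of_pos_right _ (by omega)) hn
  have hnX : n ≤ X := by
    have : 1 ≤ S.size := by unfold size; omega
    nlinarith
  unfold size at hsz
  set f : ℕ → ℚ := fun j => if j = 0 then (if t = 0 then 1 else 0) else if j = 1 then 1 else
    if j = 2 then (start + t : ℕ) else
    if j = 3 then ∑ j ∈ Finset.range (start + t + 1), (j : ℚ) else (a + 1 : ℕ) with hf
  have hsmall : ∀ j < 5, Small F X 2 (f j) := by
    intro j hj
    have hle : X ≤ X ^ 2 := by nlinarith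
    simp only [hf]
    split_ifs
    · simpa using Small.nat (F := F) (X := X) (z := 1) (k := 2) (by omega)
    · simpa using Small.nat (F := F) (X := X) (z := 0) (k := 2) (by omega)
    · simpa using Small.nat (F := F) (X := X) (z := 1) (k := 2) (by omega)
    · exact Small.nat (by omega)
    -- The triangular number of `p = start + t ≤ X` is `p * (p + 1) / 2 ≤ X ^ 2`. Its weight is zero
    -- in every neuron, but exactness of scalar products is available only for inputs that are all
    -- small.
    · rw [← Nat.cast_sum]
      refine Small.nat ?_
      have h1 := Finset.sum_range_id_mul_two (start + t + 1)
      simp only [Nat.add_sub_cancel] at h1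
      have h2 : start + t ≤ X := by omega
      have h3 : start + t ≤ (start + t) * (start + t) := Nat.le_mul_self _
      nlinarith
    · exact Small.nat (by omega)
  have hemb : (embed start (a + 1) (start + t)).map F.rnd = (List.range 5).map f := by
    have : embed start (a + 1) (start + t) = (List.range 5).map f := by
      simp [embed, hf, List.range_succ]
    rw [this, List.map_map]
    refine List.map_congr_left fun j hj => ?_
    exact (hsmall j (List.mem_range.1 hj)).rnd_eq hX (by omega)
  rw [hemb]
  unfold lookup
  have hw1 : ∀ i j, |inputWeight n i j| ≤ X := by
    intro i j
    unfold inputWeight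
    split_ifs <;> refine abs_unit_le ?_ j
    · rw [Nat.abs_cast]; exact_mod_cast hnX
    all_goals simp; omega
  rw [eval_oneHidden hX (k := 2) (by omega) (by omega) (by omega) ?_ (fun i _ j _ => hw1 i j) ?_ ?_
    hsmall]
  · refine List.map_congr_left fun o ho => ?_
    rw [Finset.sum_range_add, Finset.sum_range_add, Finset.sum_range_succ, Finset.sum_range_succ,
      Finset.sum_range_one]
    have e0 : relu (S.inputBias 0 + ∑ l ∈ Finset.range 5, (inputWeight n 0 l : ℚ) * f l) =
        if t = 0 then (n : ℚ) else 0 := by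
      simp only [inputWeight, inputBias, if_true]
      rw [sum_unit (by norm_num)]
      by_cases h : t = 0 <;> simp [hf, h, relu]
    have e1 : relu (S.inputBias 1 + ∑ l ∈ Finset.range 5, (inputWeight n 1 l : ℚ) * f l) =
        if t = 0 then 1 else 0 := by
      simp only [inputWeight, inputBias, one_ne_zero, if_false, if_true]
      rw [sum_unit (by norm_num)]
      by_cases h : t = 0 <;> simp [hf, h, relu]
    have e2 : relu (S.inputBias 2 + ∑ l ∈ Finset.range 5, (inputWeight n 2 l : ℚ) * f l) =
        ((start + t : ℕ) : ℚ) := by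
      simp only [inputWeight, inputBias, OfNat.ofNat_ne_zero, OfNat.ofNat_ne_one, if_false, if_true]
      rw [sum_unit (by norm_num)]
      simp only [hf, relu]
      simp
      positivity
    have e3 : ∀ j < S.J, relu (S.inputBias (3 + j) +
        ∑ l ∈ Finset.range 5, (inputWeight n (3 + j) l : ℚ) * f l) =
        relu ((-1 - (j : ℤ) : ℤ) + 1 * ((a + 1 : ℕ) : ℚ)) := by
      intro j hj
      simp only [inputWeight, inputBias]
      rw [if_neg (by omega), if_pos (by omega), if_neg (by omega), if_neg (by omega),
        if_neg (by omega), sum_unit (by norm_num)]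
      simp [hf]
    have e4 : ∀ j, relu (S.inputBias (3 + (S.J + j)) +
        ∑ l ∈ Finset.range 5, (inputWeight n (3 + (S.J + j)) l : ℚ) * f l) =
        relu ((-2 - (j : ℤ) : ℤ) + 1 * ((a + 1 : ℕ) : ℚ)) := by
      intro j
      simp only [inputWeight, inputBias]
      rw [if_neg (by omega), if_neg (by omega), if_neg (by omega), if_neg (by omega),
        if_neg (by omega), sum_unit (by norm_num)]
      rw [show 3 + (S.J + j) - 3 - S.J = j by omega]
      simp [hf]
    have w3 : ∀ j < S.J, S.tableWeight o (3 + j) = S.table o (j + 1) - S.table o j := by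
      intro j hj
      simp only [tableWeight]
      rw [if_neg (by omega), if_neg (by omega), if_neg (by omega), if_pos (by omega)]
      simp
    have w4 : ∀ j, S.tableWeight o (3 + (S.J + j)) = -(S.table o (j + 1) - S.table o j) := by
      intro j
      simp only [tableWeight]
      rw [if_neg (by omega), if_neg (by omega), if_neg (by omega), if_neg (by omega),
        show 3 + (S.J + j) - 3 - S.J = j by omega]
      ring
    rw [e0, e1, e2, ← Finset.sum_add_distrib]
    have : ∀ j ∈ Finset.range S.J,
        (S.tableWeight o (3 + j) : ℚ) * relu (S.inputBias (3 + j) +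
          ∑ l ∈ Finset.range 5, (inputWeight n (3 + j) l : ℚ) * f l) +
        (S.tableWeight o (3 + (S.J + j)) : ℚ) * relu (S.inputBias (3 + (S.J + j)) +
          ∑ l ∈ Finset.range 5, (inputWeight n (3 + (S.J + j)) l : ℚ) * f l) =
        (((S.table o (j + 1) - S.table o j) * (if j < a then 1 else 0) : ℤ) : ℚ) := by
      intro j hj
      have hj := Finset.mem_range.1 hj
      have := relu_sub_relu a j
      rw [e3 j hj, w3 j hj, e4 j, w4 j]
      push_cast at this ⊢
      rw [← this]
      ring
    rw [Finset.sum_congr rfl this]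
    unfold feature
    rw [← sum_steps (S.table o)]
    push_cast
    ring
  · intro i hi
    unfold inputBias
    split_ifs <;> rw [abs_le] <;> constructor <;> omega
  · intro i hi
    refine (S.abs_table_le _ _).trans ?_
    omega
  · intro i hi j hj
    refine (S.abs_tableWeight_le _ _).trans ?_
    omega

end System

/-! ### The layer that measures the violation of the inequalities -/

theorem _root_.List.range_map_append {α : Type*} (d e : ℕ) (f g : ℕ → α) :
    (List.range d).map f ++ (List.range e).map g =
      (List.range (d + e)).map fun j => if j < d then f j else g (j - d) := by
  rw [List.range_add, List.map_append, List.map_map]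
  congr 1
  · exact List.map_congr_left fun j hj => by simp [List.mem_range.1 hj]
  · exact List.map_congr_left fun j hj => by simp

theorem countP_le {n m : ℕ} (h : m < n) :
    ((List.range n).countP fun j => decide (j ≤ m)) = m + 1 := by
  obtain ⟨k, rfl⟩ := Nat.exists_eq_add_of_lt h
  rw [show m + k + 1 = (m + 1) + k by omega, List.range_add, List.countP_append, List.countP_map,
    List.countP_eq_length.2, List.countP_eq_zero.2]
  · simp
  · simp
    omega
  · simp

namespace System

variable (S : System)

/-- The head that averages the rows of the system over the prefix that ends at the position. -/
def prefixHead : Head where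
  Q := (List.range 2).map fun i => weights S.dim (if i = 0 then unit 1 (-1) else unit 0 1)
  K := (List.range 2).map fun i => weights S.dim (if i = 0 then unit 0 1 else unit 1 1)
  N := oneHidden 1 1 1 (fun _ => 0) (fun _ _ => 1) (fun _ => 0) (fun _ _ => -1)
  W := (List.range S.R).map fun r => weights S.dim (unit (3 + r) 1)

/-- A closed row is charged an amount that exceeds every possible negative average, so its relu
vanishes. The last neuron passes on the flag for bad letters. -/
def errorWeight (n i j : ℕ) : ℤ :=
  if i < S.R then
    unit (S.dim + i) (-1) j + unit (3 + S.R + i) (-((S.size * (n + 1) : ℕ) : ℤ)) j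
  else unit 2 1 j

/-- The network that measures the violation of the inequalities. -/
def errorNet (n : ℕ) : FNN :=
  oneHidden (S.dim + S.R) (S.R + 1) 2 (fun _ => 0) (S.errorWeight n) (fun _ => 0)
    fun o j => if o = 0 then (if j < S.R then 1 else 0) else unit S.R 1 j

def errorLayer (n : ℕ) : Layer := ⟨[S.prefixHead], S.errorNet n⟩

variable {S} {feat : ℕ → ℕ → ℤ} {start len : ℕ}

/-- The scalar product of `(-pos m, 1)` and `(1, pos i)` is `i - m`. Its negated relu attains the
maximum `0` exactly at the positions `i ≤ m`, so hardmax is uniform on the prefix. -/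
theorem prefixHead_score (hX : Wide F X c) (hc : 8 < c) (hd : S.dim ≤ X)
    (hfeat : ∀ t < len, ∀ o < S.dim, |feat t o| ≤ X) (h0 : ∀ t, feat t 0 = 1)
    (h1 : ∀ t, feat t 1 = (start + t : ℕ)) {m i : ℕ} (hm : m < len) (hi : i < len) :
    S.prefixHead.score F ((List.range S.dim).map fun o => (feat m o : ℚ))
      ((List.range S.dim).map fun o => (feat i o : ℚ)) = -relu ((i : ℚ) - m) := by
  have hX1 := hX.two_le
  have hsm : ∀ t < len, ∀ o < S.dim, Small F X 1 (feat t o : ℚ) := fun t ht o ho =>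
    Small.int (by simpa using hfeat t ht o ho)
  have hdim : 3 ≤ S.dim := by unfold dim; omega
  have hu : ∀ (i : ℕ) (z : ℤ), |z| ≤ 1 → ∀ j, |unit i z j| ≤ X := fun i z hz j =>
    abs_unit_le (hz.trans (by exact_mod_cast (by omega : 1 ≤ X))) j
  unfold Head.score prefixHead
  simp only
  rw [apply_weights hX (k := 1) (by omega) hd (fun i _ j _ => by split_ifs <;> apply hu <;> simp)
      (hsm m hm),
    apply_weights hX (k := 1) (by omega) hd (fun i _ j _ => by split_ifs <;> apply hu <;> simp)
      (hsm i hi)]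
  have hQ : ((List.range 2).map fun l => ∑ j ∈ Finset.range S.dim,
      ((if l = 0 then unit 1 (-1) else unit 0 1 : ℕ → ℤ) j : ℚ) * (feat m j : ℚ)) =
      (List.range 2).map fun l => ((if l = 0 then -feat m 1 else 1 : ℤ) : ℚ) := by
    refine List.map_congr_left fun l _ => ?_
    split_ifs
    · rw [sum_unit (by omega)]; simp
    · rw [sum_unit (by omega), h0]; simp
  have hK : ((List.range 2).map fun l => ∑ j ∈ Finset.range S.dim,
      ((if l = 0 then unit 0 1 else unit 1 1 : ℕ → ℤ) j : ℚ) * (feat i j : ℚ)) =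
      (List.range 2).map fun l => ((if l = 0 then 1 else feat i 1 : ℤ) : ℚ) := by
    refine List.map_congr_left fun l _ => ?_
    split_ifs
    · rw [sum_unit (by omega), h0]; simp
    · rw [sum_unit (by omega)]; simp
  rw [hQ, hK, dot_eq hX (i := 1) (k := 1) (by omega) hX1]
  · have hv : ∑ j ∈ Finset.range 2, ((if j = 0 then -feat m 1 else 1 : ℤ) : ℚ) *
        ((if j = 0 then 1 else feat i 1 : ℤ) : ℚ) = (((i : ℤ) - m : ℤ) : ℚ) := by
      simp [Finset.sum_range_succ, h1]
      ring
    rw [hv]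
    have hs : Small F X 2 (((i : ℤ) - m : ℤ) : ℚ) := by
      refine Small.int ?_
      have h2 := hfeat m hm 1 (by omega)
      have h3 := hfeat i hi 1 (by omega)
      rw [h1, Nat.abs_cast] at h2 h3
      have : (X : ℤ) ≤ X ^ 2 := by nlinarith
      rw [abs_le]
      push_cast at h2 h3
      constructor <;> omega
    have := eval_oneHidden hX (k := 2) (d := 1) (h := 1) (o := 1) (by omega) (by omega) (by omega)
      (b := fun _ => 0) (w := fun _ _ => 1) (b' := fun _ => 0) (w' := fun _ _ => -1)
      (f := fun _ => (((i : ℤ) - m : ℤ) : ℚ)) (by simp)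
      (fun _ _ _ _ => by simp; omega) (by simp) (fun _ _ _ _ => by simp; omega)
      (fun _ _ => hs)
    unfold FNN.eval₁
    have hl (x : ℚ) : [x] = (List.range 1).map fun _ => x := by simp
    rw [hl, this]
    simp
  · intro j _
    have h2 := hfeat m hm 1 (by omega)
    split_ifs
    · simpa using h2
    · simp; omega
  · intro j _
    split_ifs
    · exact Small.int (by simp; omega)
    · exact hsm i hi 1 (by omega)

/-- Integer multiples of the rounded weight are grid points, so `1 / (m + 1)` is the only quantity
that rounding changes. The result is the prefix sum times one positive factor and therefore has the
sign of the prefix sum. -/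
theorem prefixHead_attend (hX : Wide F X c) (hc : 8 < c) (hd : S.dim ≤ X) (hlen : len ≤ X)
    (hfeat : ∀ t < len, ∀ o < S.dim, |feat t o| ≤ X) (h0 : ∀ t, feat t 0 = 1)
    (h1 : ∀ t, feat t 1 = (start + t : ℕ)) {m : ℕ} (hm : m < len) :
    S.prefixHead.attend F
        ((List.range len).map fun t => (List.range S.dim).map fun o => (feat t o : ℚ))
        ((List.range S.dim).map fun o => (feat m o : ℚ)) =
      (List.range S.R).map fun r =>
        recip F (m + 1) * ((∑ i ∈ Finset.range (m + 1), feat i (3 + r) : ℤ) : ℚ) := by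
  have hX1 := hX.two_le
  unfold Head.attend
  have hsc : (List.range len).map (S.prefixHead.score F
      ((List.range S.dim).map fun o => (feat m o : ℚ)) ∘
        fun t => (List.range S.dim).map fun o => (feat t o : ℚ)) =
      (List.range len).map fun i : ℕ => -relu ((i : ℚ) - m) :=
    List.map_congr_left fun i hi =>
      prefixHead_score hX hc hd hfeat h0 h1 hm (List.mem_range.1 hi)
  rw [List.map_map, hsc]
  have hz (j : ℕ) : -relu ((j : ℚ) - m) = 0 ↔ j ≤ m := by
    unfold relu
    rw [neg_eq_zero, max_eq_left_iff, sub_nonpos, Nat.cast_le]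
  rw [pool_eq F _ len _ _ 0 (fun i _ => by simp [relu]) ⟨m, hm, (hz m).2 le_rfl⟩]
  simp only [hz, countP_le hm]
  unfold prefixHead
  simp only
  rw [List.map_map]
  refine List.map_congr_left fun r hr => ?_
  have hr := List.mem_range.1 hr
  have hR : S.dim = 3 + 2 * S.R := rfl
  simp only [Function.comp]
  obtain ⟨hg, hlo, hhi⟩ := recip_mem (F := F) hX (by omega) (by omega : 1 ≤ m + 1) (by omega)
  have hpos : 0 < recip F (m + 1) := by
    have : 0 < 1 / (X : ℚ) := by have := hX.one_le; positivity
    linarith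
  have hs : ∀ i < len, Small F X 1 (recip F (m + 1) * feat i (3 + r)) := by
    intro i hi
    rw [mul_comm]
    refine Small.int_mul (i := 1) (k := 0) (by simpa using hfeat i hi (3 + r) (by omega)) ⟨hg, ?_⟩
    rw [abs_of_pos hpos]
    simpa using hhi
  have hs' : ∀ i < len, Small F X 1 (if i ≤ m then recip F (m + 1) * feat i (3 + r) else 0) := by
    intro i hi
    split_ifs
    · exact hs i hi
    · simpa using Small.int (F := F) (X := X) (z := 0) (k := 1) (by simp)
  have : ((List.range len).map fun i => F.mul (if i ≤ m then recip F (m + 1) else 0)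
      (F.dot (params F (weights S.dim (unit (3 + r) 1)))
        ((List.range S.dim).map fun o => (feat i o : ℚ)))) =
      (List.range len).map fun i => if i ≤ m then recip F (m + 1) * feat i (3 + r) else 0 := by
    refine List.map_congr_left fun i hi => ?_
    have hi := List.mem_range.1 hi
    rw [dot_weights hX (k := 1) (by omega) hd
      (fun j _ => abs_unit_le (by simp; omega) j)
      (fun j hj => Small.int (by simpa using hfeat i hi j hj)), sum_unit (by omega)]
    rw [← (hs' i hi).rnd_eq hX (by omega)]
    unfold FixedPoint.mul
    split_ifs <;> simp
  rw [this, Small.fsum_eq hX (by omega) hlen hs', ← Finset.sum_filter]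
  push_cast
  rw [Finset.mul_sum]
  refine Finset.sum_congr ?_ fun _ _ => rfl
  ext i
  simp
  omega

/-- The violation of the inequalities at position `m`. -/
def error (F : FixedPoint) (S : System) (n : ℕ) (feat : ℕ → ℕ → ℤ) (m : ℕ) : ℚ :=
  ∑ r ∈ Finset.range S.R,
    relu (-(recip F (m + 1) * ((∑ i ∈ Finset.range (m + 1), feat i (3 + r) : ℤ) : ℚ)) -
      (S.size * (n + 1) : ℕ) * feat m (3 + S.R + r))

theorem errorLayer_eval (hX : Wide F X c) (hc : 10 < c) {n : ℕ} (hn : S.size * (n + 1) < X)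
    (hlen : len ≤ X)
    (hfeat : ∀ t < len, ∀ o < S.dim, |feat t o| ≤ X) (h0 : ∀ t, feat t 0 = 1)
    (h1 : ∀ t, feat t 1 = (start + t : ℕ)) (h2 : ∀ t, 0 ≤ feat t 2) :
    (S.errorLayer n).eval F
        ((List.range len).map fun t => (List.range S.dim).map fun o => (feat t o : ℚ)) =
      (List.range len).map fun m => (List.range 2).map fun o =>
        if o = 0 then error F S n feat m else (feat m 2 : ℚ) := by
  have hX1 := hX.two_le
  have hsz : S.size ≤ X := le_trans (Nat.le_mul_of_pos_right _ (by omega)) hn.le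
  unfold size at hsz
  have hR : S.dim = 3 + 2 * S.R := rfl
  have hd : S.dim ≤ X := by omega
  unfold Layer.eval errorLayer
  simp only [List.map_cons, List.map_nil, List.flatten_cons, List.flatten_nil, List.append_nil]
  rw [List.map_map]
  refine List.map_congr_left fun m hm => ?_
  have hm := List.mem_range.1 hm
  simp only [Function.comp]
  rw [prefixHead_attend hX (by omega) hd hlen hfeat h0 h1 hm, List.range_map_append]
  obtain ⟨hg, hlo, hhi⟩ := recip_mem (F := F) hX (by omega) (by omega : 1 ≤ m + 1) (by omega)
  have hpos : 0 < recip F (m + 1) := by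
    have : 0 < 1 / (X : ℚ) := by have := hX.one_le; positivity
    linarith
  have hy : ∀ r < S.R, Small F X 2
      (recip F (m + 1) * ((∑ i ∈ Finset.range (m + 1), feat i (3 + r) : ℤ) : ℚ)) := by
    intro r hr
    rw [mul_comm]
    refine Small.int_mul (i := 2) (k := 0) ?_ ⟨hg, ?_⟩
    · have h := (Small.sum (F := F) (X := X) (k := 1) (d := m + 1)
        (f := fun i => (feat i (3 + r) : ℚ)) (by omega) fun i hi =>
          Small.int (by simpa using hfeat i (by omega) (3 + r) (by omega))).2
      exact_mod_cast h
    · rw [abs_of_pos hpos]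
      simpa using hhi
  unfold errorNet
  rw [eval_oneHidden hX (k := 2) (by omega) (by omega) (by omega) (by simp) ?_ (by simp) ?_ ?_]
  · refine List.map_congr_left fun o ho => ?_
    rw [Finset.sum_range_succ]
    have e1 : ∀ r < S.R, relu ((0 : ℤ) + ∑ l ∈ Finset.range (S.dim + S.R),
        (S.errorWeight n r l : ℚ) * (if l < S.dim then (feat m l : ℚ) else
          recip F (m + 1) * ((∑ i ∈ Finset.range (m + 1), feat i (3 + (l - S.dim)) : ℤ) : ℚ))) =
        relu (-(recip F (m + 1) * ((∑ i ∈ Finset.range (m + 1), feat i (3 + r) : ℤ) : ℚ)) -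
          (S.size * (n + 1) : ℕ) * feat m (3 + S.R + r)) := by
      intro r hr
      unfold errorWeight
      simp only [hr, if_true, Int.cast_add, add_mul, Finset.sum_add_distrib]
      rw [sum_unit (by omega), sum_unit (by omega), if_neg (by omega), if_pos (by omega),
        Nat.add_sub_cancel_left]
      congr 1
      push_cast
      ring
    have e2 : relu ((0 : ℤ) + ∑ l ∈ Finset.range (S.dim + S.R),
        (S.errorWeight n S.R l : ℚ) * (if l < S.dim then (feat m l : ℚ) else
          recip F (m + 1) * ((∑ i ∈ Finset.range (m + 1), feat i (3 + (l - S.dim)) : ℤ) : ℚ))) =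
        feat m 2 := by
      unfold errorWeight
      simp only [lt_irrefl, if_false]
      rw [sum_unit (by omega), if_pos (by omega)]
      have : (0 : ℚ) ≤ feat m 2 := by exact_mod_cast h2 m
      simp [relu, this]
    rw [e2, Finset.sum_congr rfl fun r hr => by rw [e1 r (Finset.mem_range.1 hr)]]
    by_cases ho0 : o = 0
    · simp only [ho0, if_true, lt_irrefl, if_false, Int.cast_zero, zero_mul, add_zero, zero_add,
        error]
      refine Finset.sum_congr rfl fun r hr => ?_
      rw [if_pos (Finset.mem_range.1 hr), Int.cast_one, one_mul]
    · simp only [ho0, if_false]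
      rw [Finset.sum_eq_zero]
      · simp [unit]
      · intro r hr
        have : r ≠ S.R := by have := Finset.mem_range.1 hr; omega
        simp [unit, this]
  · intro i hi j hj
    unfold errorWeight
    split_ifs
    · refine (abs_add_le _ _).trans ?_
      have a1 := abs_unit_le (i := S.dim + i) (z := -1) (B := 1) (by simp) j
      have a2 := abs_unit_le (i := 3 + S.R + i) (z := -((S.size * (n + 1) : ℕ) : ℤ))
        (B := S.size * (n + 1)) (by rw [abs_neg, Nat.abs_cast]) j
      omega
    · exact abs_unit_le (by simp; omega) j
  · intro i hi j hj
    split_ifs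
    · simp; omega
    · simp
    · exact abs_unit_le (by simp; omega) j
  · intro j hj
    split_ifs with h
    · exact Small.mono hX (k := 1) (by omega) (Small.int (by simpa using hfeat m hm j h))
    · exact hy _ (by omega)

/-! ### The last layer -/

/-- The head that averages the first coordinate over the whole word. -/
def meanHead : Head := ⟨[], [], flat 1 0 (fun _ => 0), [weights 2 (unit 0 1)]⟩

/-- The value is `1` minus the flag for a bad letter minus the mean violation. Both subtracted terms
are nonnegative, so it equals `1` only if both vanish. -/
def verdictLayer : Layer := ⟨[meanHead], flat 3 1 fun j => if j = 0 then 0 else -1⟩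

theorem meanHead_attend (hX : Wide F X c) {k : ℕ} (hk : k + 2 < c) {e b : ℕ → ℚ}
    (he : ∀ t < len, Small F X k (e t)) (hb : ∀ t < len, Small F X k (b t))
    {m : ℕ} (hm : m < len) :
    meanHead.attend F ((List.range len).map fun t => (List.range 2).map fun o =>
        if o = 0 then e t else b t) ((List.range 2).map fun o => if o = 0 then e m else b m) =
      [F.sum ((List.range len).map fun t => F.rnd (recip F len * e t))] := by
  have hX1 := hX.two_le
  unfold Head.attend
  rw [List.map_map]
  have hsc : (meanHead.score F ((List.range 2).map fun o => if o = 0 then e m else b m)) ∘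
      (fun t => (List.range 2).map fun o => if o = 0 then e t else b t) =
      fun _ => meanHead.score F [] [] := by
    funext t
    rfl
  rw [hsc, pool_eq F _ len _ _ (meanHead.score F [] []) (fun _ _ => le_rfl) ⟨m, hm, rfl⟩]
  simp only [if_true, decide_true, List.countP_true, List.length_range]
  unfold meanHead
  simp only [List.map_cons, List.map_nil]
  congr 2
  refine List.map_congr_left fun t ht => ?_
  have ht := List.mem_range.1 ht
  rw [dot_weights hX (k := k) (by omega) hX1 (fun j _ => abs_unit_le (by simp; omega) j) ?_,
    sum_unit (by omega)]
  · simp [FixedPoint.mul]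
  · intro j _
    split_ifs
    · exact he t ht
    · exact hb t ht

/-- A nonzero violation is at least `1 / X`, and so is the weight. Their product is at least `1 / X
^ 2`, hence at least one grid step, and does not become zero even when rounded down; no violation is
lost in the mean. -/
theorem mean_eq_zero_iff (hX : Wide F X c) {k : ℕ} (hk : k + 2 < c) (hlen : len ≤ X) {e : ℕ → ℚ}
    (he : ∀ t < len, Small F X k (e t))
    (hpos : ∀ t < len, e t = 0 ∨ 1 / (X : ℚ) ≤ e t) :
    Small F X (k + 1) (F.sum ((List.range len).map fun t => F.rnd (recip F len * e t))) ∧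
    0 ≤ F.sum ((List.range len).map fun t => F.rnd (recip F len * e t)) ∧
    (F.sum ((List.range len).map fun t => F.rnd (recip F len * e t)) = 0 ↔
      ∀ t < len, e t = 0) := by
  have hX1 := hX.one_le
  have hXi : 0 < 1 / (X : ℚ) := by positivity
  have key : ∀ t < len, Small F X k (F.rnd (recip F len * e t)) ∧
      0 ≤ F.rnd (recip F len * e t) ∧ (F.rnd (recip F len * e t) = 0 ↔ e t = 0) := by
    intro t ht
    obtain ⟨hg, hlo, hhi⟩ := recip_mem (F := F) hX (by omega) (by omega : 1 ≤ len) hlen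
    have hbd := (he t ht).2.trans_lt (hX.lt (k := k) (by omega))
    rcases hpos t ht with h | h
    · have h0 : F.rnd 0 = 0 := FixedPoint.rnd_eq .zero (by simp)
      rw [h, mul_zero, h0]
      exact ⟨⟨.zero, by simp⟩, le_rfl, by simp⟩
    · have het : 0 < e t := hXi.trans_le h
      have hp : (0 : ℚ) < 2 ^ F.fracBits := by positivity
      have hr0 : 0 ≤ recip F len := hXi.le.trans hlo
      have hXX : 1 / (2 : ℚ) ^ F.fracBits ≤ recip F len * e t := by
        calc 1 / (2 : ℚ) ^ F.fracBits ≤ 1 / (X : ℚ) ^ 2 := by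
              apply one_div_le_one_div_of_le (by positivity)
              exact_mod_cast hX.sq_frac
          _ = 1 / X * (1 / X) := by field_simp
          _ ≤ recip F len * e t := by gcongr
      -- The product is enclosed by the smallest positive grid point and the grid point `e t`.
      have hm := FixedPoint.rnd_mem (F := F) (a := 1 / 2 ^ F.fracBits) (b := e t)
        (x := recip F len * e t) ⟨1, by simp⟩ (he t ht).1 hXX
        (mul_le_of_le_one_left het.le hhi) ?_ hbd
      · have hp' : 0 < 1 / (2 : ℚ) ^ F.fracBits := by positivity
        have h3 := hp'.trans_le hm.1
        refine ⟨⟨.rnd _, ?_⟩, h3.le, by simp [h3.ne', het.ne']⟩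
        rw [abs_of_pos h3]
        exact hm.2.trans ((le_abs_self _).trans (he t ht).2)
      · rw [abs_of_pos (by positivity)]
        have : 1 / (2 : ℚ) ^ F.fracBits ≤ 1 :=
          (div_le_one hp).2 (one_le_pow₀ (by norm_num))
        have h2 : (X : ℚ) < 2 ^ F.intBits := by simpa using hX.lt (k := 1) (by omega)
        linarith
  rw [Small.fsum_eq hX (k := k) (by omega) hlen fun t ht => (key t ht).1]
  refine ⟨Small.sum hlen fun t ht => (key t ht).1,
    Finset.sum_nonneg fun t ht => (key t (Finset.mem_range.1 ht)).2.1, ?_⟩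
  rw [Finset.sum_eq_zero_iff_of_nonneg fun t ht => (key t (Finset.mem_range.1 ht)).2.1]
  simp only [Finset.mem_range]
  exact forall₂_congr fun t ht => (key t ht).2.2

theorem verdictLayer_eval (hX : Wide F X c) {k : ℕ} (hk : k + 4 < c) (hX3 : 3 ≤ X) (hlen : len ≤ X)
    {e b : ℕ → ℚ} (he : ∀ t < len, Small F X k (e t)) (hb : ∀ t < len, Small F X k (b t))
    (hpos : ∀ t < len, e t = 0 ∨ 1 / (X : ℚ) ≤ e t) :
    verdictLayer.eval F ((List.range len).map fun t => (List.range 2).map fun o =>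
        if o = 0 then e t else b t) =
      (List.range len).map fun m =>
        [1 - b m - F.sum ((List.range len).map fun t => F.rnd (recip F len * e t))] := by
  unfold Layer.eval verdictLayer
  simp only [List.map_cons, List.map_nil, List.flatten_cons, List.flatten_nil, List.append_nil]
  rw [List.map_map]
  refine List.map_congr_left fun m hm => ?_
  have hm := List.mem_range.1 hm
  simp only [Function.comp]
  rw [meanHead_attend hX (k := k) (by omega) he hb hm]
  have hM := (mean_eq_zero_iff hX (k := k) (by omega) hlen he hpos).1
  set M := F.sum ((List.range len).map fun t => F.rnd (recip F len * e t))
  have hl : ((List.range 2).map fun o => if o = 0 then e m else b m) ++ [M] =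
      (List.range 3).map fun o => if o = 0 then e m else if o = 1 then b m else M := by
    simp [List.range_succ]
  rw [hl, eval_flat hX (k := k + 1) (by omega) hX3 (by simp; omega) ?_ ?_]
  · simp [Finset.sum_range_succ]
    ring
  · intro j _
    split_ifs
    · simp
    · simp; omega
  · intro j _
    split_ifs
    · exact (he m hm).mono hX (by omega)
    · exact (hb m hm).mono hX (by omega)
    · exact hM

end System

/-! ### The encoder of a system and its correctness -/

namespace System

variable (S : System)

/-- The encoder that accepts the words over `0, …, size * (n + 1) - 1` that the system accepts for
the input `n` if all letters beyond `J` are read as `J`. -/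
def encoder (n : ℕ) : TE where
  alphabetSize := S.size * (n + 1)
  layers := [S.lookupLayer n, S.errorLayer n, verdictLayer]
  out := flat 1 0 fun _ => 1

theorem encoder_wellFormed (n : ℕ) : (S.encoder n).WellFormed := by
  have hw (d : ℕ) (w : ℕ → ℤ) : (weights d w).length = d := by simp [weights]
  refine ⟨by simp [encoder], ?_, ?_, ?_, ?_⟩
  · refine ⟨by simp [lookupLayer], ?_, ?_⟩
    · simp only [lookupLayer, List.mem_singleton]
      rintro A rfl
      exact ⟨by simp [idleHead, Mat.HasCols], by simp [idleHead, Mat.HasCols], rfl,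
        hasDims_flat _ _ _, by simp [idleHead, Mat.HasCols]⟩
    · exact ⟨(hasDims_oneHidden _ _ _ _ _ _ _).1, rfl⟩
  · have hl : (S.lookupLayer n).comb.output.length = S.dim := (hasDims_oneHidden _ _ _ _ _ _ _).2
    rw [hl]
    refine ⟨by simp [errorLayer], ?_, ?_⟩
    · simp only [errorLayer, List.mem_singleton]
      rintro A rfl
      refine ⟨?_, ?_, by simp [prefixHead], hasDims_oneHidden _ _ _ _ _ _ _, ?_⟩ <;>
      · intro r hr
        obtain ⟨i, -, rfl⟩ := List.mem_map.1 hr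
        exact hw _ _
    · have : (List.map (fun A : Head => A.W.length) (S.errorLayer n).heads).sum = S.R := by
        simp [errorLayer, prefixHead]
      rw [this]
      exact ⟨(hasDims_oneHidden _ _ _ _ _ _ _).1, rfl⟩
  · have hl : (S.errorLayer n).comb.output.length = 2 := (hasDims_oneHidden _ _ _ _ _ _ _).2
    rw [hl]
    refine ⟨by simp [verdictLayer], ?_, ?_⟩
    · simp only [verdictLayer, List.mem_singleton]
      rintro A rfl
      exact ⟨by simp [meanHead, Mat.HasCols], by simp [meanHead, Mat.HasCols], rfl,
        hasDims_flat _ _ _, by simp [meanHead, Mat.HasCols, hw]⟩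
    · exact ⟨(hasDims_flat _ _ _).1, rfl⟩
  · exact hasDims_flat _ _ _

variable {S} {start n : ℕ} {a : ℕ → ℕ}

theorem feature_zero (t : ℕ) : S.feature start n (a t) t 0 = 1 := by
  simp [feature, table, tableWeight]

theorem feature_one (t : ℕ) : S.feature start n (a t) t 1 = (start + t : ℕ) := by
  simp [feature, table, tableWeight]

theorem feature_two (t : ℕ) : S.feature start n (a t) t 2 = (S.bad (min (a t) S.J)).toInt := by
  simp [feature, table, tableWeight]

theorem feature_step {r : ℕ} (hr : r < S.R) (t : ℕ) : S.feature start n (a t) t (3 + r) =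
    S.step r (min (a t) S.J) + (if t = 0 then S.init r + n * S.coeff r else 0) := by
  simp only [feature, table, tableWeight]
  rw [if_neg (by omega), if_neg (by omega), if_neg (by omega), if_pos (by omega)]
  have h1 : 3 + r ≠ 1 := by omega
  by_cases ht : t = 0
  · simp [hr, h1, ht]
    ring
  · simp [h1, ht]

theorem feature_closed {r : ℕ} (t : ℕ) : S.feature start n (a t) t (3 + S.R + r) =
    (S.closed r (min (a t) S.J)).toInt := by
  simp only [feature, table, tableWeight]
  rw [if_neg (by omega), if_neg (by omega), if_neg (by omega), if_neg (by omega),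
    show 3 + S.R + r - 3 - S.R = r by omega]
  have h2 : 3 + S.R + r ≠ 1 := by omega
  simp [h2]

theorem sum_feature {r : ℕ} (hr : r < S.R) (m : ℕ) :
    ∑ i ∈ Finset.range (m + 1), S.feature start n (a i) i (3 + r) =
      S.value n (fun t => min (a t) S.J) r m := by
  unfold value
  rw [Finset.sum_congr rfl fun i _ => feature_step hr i, Finset.sum_add_distrib,
    Finset.sum_ite_eq' (Finset.range (m + 1)) 0]
  simp
  ring

theorem abs_feature_le (hn : S.size * (n + 1) < X) {t : ℕ} (ht : start + t ≤ X) {o : ℕ}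
    (ho : o < S.dim) : |S.feature start n (a t) t o| ≤ X := by
  unfold size at hn
  have hX : 1 ≤ X := by omega
  have hdim : S.dim = 3 + 2 * S.R := rfl
  obtain h | h | h | ⟨r, hr, rfl⟩ | ⟨r, rfl⟩ : o = 0 ∨ o = 1 ∨ o = 2 ∨
      (∃ r < S.R, o = 3 + r) ∨ ∃ r, o = 3 + S.R + r := by
    by_cases h3 : o < 3
    · omega
    · by_cases h4 : o < 3 + S.R
      · exact .inr (.inr (.inr (.inl ⟨o - 3, by omega, by omega⟩)))
      · exact .inr (.inr (.inr (.inr ⟨o - 3 - S.R, by omega⟩)))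
  · rw [h, feature_zero]; simp; omega
  · rw [h, feature_one, Nat.abs_cast]; exact_mod_cast ht
  · rw [h, feature_two]
    have := toInt_mem (S.bad (min (a t) S.J))
    rw [abs_le]; constructor <;> omega
  · rw [feature_step hr]
    have h1 := abs_le.1 (S.step_le r (min (a t) S.J))
    have h2 := abs_le.1 (S.init_le r)
    have h3 := abs_le.1 (S.coeff_le r)
    have h4 : (n : ℤ) * S.coeff r ≤ n * S.D := by nlinarith
    have h5 : -((n : ℤ) * S.D) ≤ n * S.coeff r := by nlinarith
    have h6 : (2 * S.D + n * S.D : ℤ) ≤ X := by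
      have : 2 * S.D + n * S.D ≤ X := by nlinarith
      exact_mod_cast this
    have h7 : (0 : ℤ) ≤ n * S.D := by positivity
    rw [abs_le]
    split_ifs <;> constructor <;> linarith
  · rw [feature_closed]
    have := toInt_mem (S.closed r (min (a t) S.J))
    rw [abs_le]; constructor <;> omega

theorem abs_value_le (n : ℕ) (b : ℕ → ℕ) (r m : ℕ) :
    |S.value n b r m| ≤ S.D * (n + 1) + S.D * (m + 1) := by
  have h1 : |∑ i ∈ Finset.range (m + 1), S.step r (b i)| ≤ (m + 1) * S.D := by
    refine (Finset.abs_sum_le_sum_abs _ _).trans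
      ((Finset.sum_le_card_nsmul _ _ _ fun i _ => S.step_le r (b i)).trans ?_)
    simp
  have h2 : |(n : ℤ) * S.coeff r| ≤ n * S.D := by
    rw [abs_mul, Nat.abs_cast]
    have := S.coeff_le r
    gcongr
  have h3 := S.init_le r
  unfold value
  rw [abs_le] at *
  constructor <;> linarith

/-- For an open row, a negative integer `V` is at most `-1` and the weight is at least `1 / X`,
which gives the gap. For a closed row, the weight is at most `1` and `m + 1` times it is at most
`2`, so the average is at least `-(D * (n + 1) + 2 * D)`, which the charge `size * (n + 1)`
outweighs. -/
theorem error_term (hX : Wide F X c) (hc : 10 < c) {m : ℕ}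
    (hm : m + 1 ≤ X) (V : ℤ) (hV : |V| ≤ S.D * (n + 1) + S.D * (m + 1)) (b : Bool) :
    let x := relu (-(recip F (m + 1) * (V : ℚ)) - (S.size * (n + 1) : ℕ) * (b.toInt : ℚ))
    (x = 0 ∨ 1 / (X : ℚ) ≤ x) ∧ (x = 0 ↔ (b = false → 0 ≤ V)) := by
  intro x
  obtain ⟨hg, hlo, hhi⟩ := recip_mem (F := F) hX (by omega) (by omega : 1 ≤ m + 1) (by omega)
  have h2 := mul_recip_le (F := F) hX (by omega) (by omega : 1 ≤ m + 1) (by omega)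
  have hX1 := hX.one_le
  have hXi : 0 < 1 / (X : ℚ) := by positivity
  set u := recip F (m + 1)
  cases b
  · have hx : x = max 0 (-(u * V)) := by simp [x, u, relu]
    by_cases hV0 : 0 ≤ V
    · have : x = 0 := by
        rw [hx, max_eq_left_iff, neg_nonpos]
        have : (0 : ℚ) ≤ V := by exact_mod_cast hV0
        exact mul_nonneg (by linarith) this
      exact ⟨.inl this, by simp [this, hV0]⟩
    · have hV1 : (V : ℚ) ≤ -1 := by exact_mod_cast (by omega : V ≤ -1)
      have hle : 1 / (X : ℚ) ≤ x := by
        rw [hx]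
        refine le_max_of_le_right ?_
        nlinarith
      refine ⟨.inr hle, ?_⟩
      have : x ≠ 0 := by linarith
      simp [this, hV0]
  · have : x = 0 := by
      simp only [x, relu]
      rw [max_eq_left_iff]
      have h3 : -(S.D * (n + 1) + S.D * (m + 1) : ℚ) ≤ V := by exact_mod_cast (abs_le.1 hV).1
      have hD : (0 : ℚ) ≤ S.D := by positivity
      have hs : (S.D * (n + 1) + 2 * S.D : ℚ) ≤ (S.size * (n + 1) : ℕ) := by
        have : S.D * (n + 1) + 2 * S.D ≤ S.size * (n + 1) := by unfold size; nlinarith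
        exact_mod_cast this
      have h4 : u * (-(S.D * (n + 1) + S.D * (m + 1) : ℚ)) ≤ u * V := by
        apply mul_le_mul_of_nonneg_left h3; linarith
      have h5 : u * (S.D * (n + 1)) ≤ S.D * (n + 1) :=
        mul_le_of_le_one_left (by positivity) hhi
      push_cast at h2 hs ⊢
      have h6 : S.D * (((m : ℚ) + 1) * u) ≤ S.D * 2 := by gcongr
      simp only [Bool.toInt_true, Int.cast_one, mul_one]
      linarith
    exact ⟨.inl this, by simp [this]⟩

theorem error_mem (hX : Wide F X c) (hc : 10 < c) (hn : S.size * (n + 1) < X) {m : ℕ}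
    (hm : m + 1 ≤ X) :
    let e := error F S n (fun t => S.feature start n (a t) t) m
    Small F X 4 e ∧ (e = 0 ∨ 1 / (X : ℚ) ≤ e) ∧
      (e = 0 ↔ ∀ r < S.R, S.closed r (min (a m) S.J) = false →
        0 ≤ S.value n (fun t => min (a t) S.J) r m) := by
  intro e
  have hsz : S.size ≤ X := le_trans (Nat.le_mul_of_pos_right _ (by omega)) hn.le
  unfold size at hsz
  have he : e = ∑ r ∈ Finset.range S.R, relu (-(recip F (m + 1) *
      (S.value n (fun t => min (a t) S.J) r m : ℚ)) -
        (S.size * (n + 1) : ℕ) * ((S.closed r (min (a m) S.J)).toInt : ℚ)) := by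
    refine Finset.sum_congr rfl fun r hr => ?_
    simp only [sum_feature (Finset.mem_range.1 hr), feature_closed]
  have hterm := fun r => error_term (S := S) hX hc hm _
    (abs_value_le n (fun t => min (a t) S.J) r m) (S.closed r (min (a m) S.J))
  have hnn : ∀ r, 0 ≤ relu (-(recip F (m + 1) *
      (S.value n (fun t => min (a t) S.J) r m : ℚ)) -
        (S.size * (n + 1) : ℕ) * ((S.closed r (min (a m) S.J)).toInt : ℚ)) := fun r =>
    le_max_left _ _
  refine ⟨?_, ?_, ?_⟩
  · rw [he]
    refine Small.sum (k := 3) (by omega) fun r hr => (Small.relu ?_)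
    obtain ⟨hg, hlo, hhi⟩ := recip_mem (F := F) hX (by omega) (by omega : 1 ≤ m + 1) (by omega)
    have h0 : 0 < 1 / (X : ℚ) := by have := hX.one_le; positivity
    have h1 := Small.int_mul (F := F) (X := X) (i := 2) (k := 0) (x := recip F (m + 1))
      (z := -S.value n (fun t => min (a t) S.J) r m) ?_ ⟨hg, ?_⟩
    · have h2 := Small.int_mul (F := F) (X := X) (i := 1) (k := 1)
        (x := ((S.closed r (min (a m) S.J)).toInt : ℚ)) (z := -((S.size * (n + 1) : ℕ) : ℤ)) ?_
        (Small.int ?_)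
      · convert Small.add hX h1 h2 using 1
        push_cast
        ring
      · rw [abs_neg, Nat.abs_cast, pow_one]
        exact_mod_cast hn.le
      · have := toInt_mem (S.closed r (min (a m) S.J))
        rw [abs_le, pow_one]
        constructor <;> omega
    · rw [abs_neg]
      refine (abs_value_le n (fun t => min (a t) S.J) r m).trans ?_
      have h3 : S.D * (n + 1) ≤ X := by unfold size at hn; nlinarith
      have h4 : S.D * (m + 1) + X ≤ X ^ 2 := by
        have : 4 * S.D + 5 ≤ X := by omega
        nlinarith
      exact_mod_cast (by omega : S.D * (n + 1) + S.D * (m + 1) ≤ X ^ 2)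
    · rw [abs_of_pos (by linarith)]
      simpa using hhi
  · rw [he]
    by_cases h : ∃ r < S.R, 1 / (X : ℚ) ≤ relu (-(recip F (m + 1) *
      (S.value n (fun t => min (a t) S.J) r m : ℚ)) -
        (S.size * (n + 1) : ℕ) * ((S.closed r (min (a m) S.J)).toInt : ℚ))
    · obtain ⟨r, hr, h⟩ := h
      exact .inr (h.trans (Finset.single_le_sum (fun r _ => hnn r) (Finset.mem_range.2 hr)))
    · push Not at h
      refine .inl (Finset.sum_eq_zero fun r hr => ?_)
      exact (hterm r).1.resolve_right (not_le.2 (h r (Finset.mem_range.1 hr)))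
  · rw [he, Finset.sum_eq_zero_iff_of_nonneg fun r _ => hnn r]
    simp only [Finset.mem_range]
    exact forall₂_congr fun r _ => (hterm r).2

/-- The output is `1 - bad - M` with `bad` in `{0, 1}` and `M ≥ 0` the rounded mean violation. It is
`1` exactly if the last letter is not bad and `M = 0`, that is, if no inequality is violated
anywhere. -/
theorem encoder_eval (hX : Wide F X c) (hc : 16 < c) (hn : S.size * (n + 1) < X)
    (hs : start ≤ 1) (w : List (Fin (S.encoder n).alphabetSize)) (hw : w ≠ [])
    (hlen : w.length < X) :
    (S.encoder n).eval F start w = 1 ↔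
      S.Accepts n w.length fun t => min ((w.map Fin.val).getD t 0) S.J := by
  set a : ℕ → ℕ := fun t => (w.map Fin.val).getD t 0 with ha
  have hpos : 0 < w.length := List.length_pos_iff.2 hw
  have hsz : S.size ≤ X := le_trans (Nat.le_mul_of_pos_right _ (by omega)) hn.le
  unfold size at hsz
  have hat : ∀ t < w.length, a t < S.size * (n + 1) := by
    intro t ht
    have h : a t = (w[t]).val := by simp [ha, ht]
    rw [h]
    exact (w[t]).isLt
  have hemb : embedWord F start w =
      (List.range w.length).map fun t => (embed start (a t + 1) (start + t)).map F.rnd := by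
    unfold embedWord
    refine List.ext_getElem (by simp) fun t h1 h2 => ?_
    have ht : t < w.length := by simpa using h1
    simp [ha, ht]
  have hfeat : ∀ t < w.length, ∀ o < S.dim, |S.feature start n (a t) t o| ≤ X :=
    fun t ht o ho => abs_feature_le hn (by omega) ho
  have h1 : (S.lookupLayer n).eval F (embedWord F start w) = (List.range w.length).map fun t =>
      (List.range S.dim).map fun o => (S.feature start n (a t) t o : ℚ) := by
    rw [hemb]
    unfold Layer.eval lookupLayer
    rw [List.map_map]
    refine List.map_congr_left fun t ht => ?_
    have ht := List.mem_range.1 ht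
    have := hat t ht
    rw [← S.lookup_eval hX (by omega) hn.le hs (a := a t) (t := t) (by omega) (by omega)]
    simp [Head.attend, Head.pool, idleHead]
  have h2 := errorLayer_eval (feat := fun t => S.feature start n (a t) t) hX (by omega) hn hlen.le
    hfeat feature_zero feature_one
    (fun t => by rw [feature_two]; exact (toInt_mem _).1)
  have hE := fun t (ht : t < w.length) => error_mem (F := F) (a := a) (start := start) hX (by omega)
    hn (by omega : t + 1 ≤ X)
  have hb : ∀ t < w.length, Small F X 4 (S.feature start n (a t) t 2 : ℚ) := fun t ht =>
    (Small.int (k := 1) (by simpa using hfeat t ht 2 (by unfold dim; omega))).mono hX (by omega)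
  have h3 := verdictLayer_eval hX (k := 4) (by omega) (by omega) hlen.le
    (e := error F S n fun t => S.feature start n (a t) t)
    (b := fun t => (S.feature start n (a t) t 2 : ℚ)) (fun t ht => (hE t ht).1) hb
    (fun t ht => (hE t ht).2.1)
  obtain ⟨hM, hM0, hMz⟩ := mean_eq_zero_iff hX (k := 4) (by omega) hlen.le
    (e := error F S n fun t => S.feature start n (a t) t) (fun t ht => (hE t ht).1)
    (fun t ht => (hE t ht).2.1)
  have hfold : (S.encoder n).layers.foldl (fun xs l => l.eval F xs) (embedWord F start w) =
      verdictLayer.eval F ((S.errorLayer n).eval F ((S.lookupLayer n).eval F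
        (embedWord F start w))) := rfl
  unfold TE.eval
  rw [hfold, h1, h2, h3]
  set M := F.sum ((List.range w.length).map fun t =>
    F.rnd (recip F w.length * error F S n (fun t => S.feature start n (a t) t) t))
  have hlast : ((List.range w.length).map fun m =>
      [1 - (S.feature start n (a m) m 2 : ℚ) - M]).getLastD [] =
      (List.range 1).map fun _ =>
        1 - (S.feature start n (a (w.length - 1)) (w.length - 1) 2 : ℚ) - M := by
    obtain ⟨k, hk⟩ := Nat.exists_eq_succ_of_ne_zero hpos.ne'
    rw [hk]
    simp [List.range_succ]
  have hv : Small F X 6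
      (1 - (S.feature start n (a (w.length - 1)) (w.length - 1) 2 : ℚ) - M) := by
    have hb' := hb (w.length - 1) (by omega)
    have e1 : Small F X 5 (((1 - S.feature start n (a (w.length - 1)) (w.length - 1) 2 : ℤ)) : ℚ) := by
      refine Small.mono hX (k := 1) (by omega) (Small.int ?_)
      rw [feature_two]
      have := toInt_mem (S.bad (min (a (w.length - 1)) S.J))
      rw [abs_le, pow_one]
      constructor <;> omega
    have e2 := Small.int_mul (i := 0) (z := -1) (by simp) hM
    rw [zero_add] at e2
    convert Small.add hX e1 e2 using 1
    push_cast
    ring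
  have hout : (S.encoder n).out = flat 1 0 fun _ => 1 := rfl
  rw [hlast, hout]
  unfold FNN.eval₁
  rw [eval_flat hX (k := 6) (by omega) (by omega) (by simp) (fun _ _ => by simp; omega)
    fun _ _ => hv]
  have hbad := toInt_mem (S.bad (min (a (w.length - 1)) S.J))
  rw [feature_two]
  have hb0 : (0 : ℚ) ≤ ((S.bad (min (a (w.length - 1)) S.J)).toInt : ℚ) := by
    exact_mod_cast hbad.1
  simp only [Finset.sum_range_one, Int.cast_zero, Int.cast_one, one_mul, zero_add, List.headD_cons]
  have hiff : (1 - ((S.bad (min (a (w.length - 1)) S.J)).toInt : ℚ) - M = 1) ↔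
      M = 0 ∧ S.bad (min (a (w.length - 1)) S.J) = false := by
    constructor
    · intro h
      refine ⟨by linarith, ?_⟩
      have h0 : ((S.bad (min (a (w.length - 1)) S.J)).toInt : ℚ) = 0 := by linarith
      cases hbb : S.bad (min (a (w.length - 1)) S.J)
      · rfl
      · rw [hbb] at h0
        simp at h0
    · rintro ⟨h, h'⟩
      simp [h, h']
  rw [hiff, hMz]
  unfold Accepts
  exact and_congr (forall₂_congr fun t ht => (hE t ht).2.2) Iff.rfl

/-- The power of two `2 ^ Nat.size N` exceeds `N` and divides `2 ^ fracBits`. Its `c`-th power costs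
`c * Nat.size N` bits, which is what rates of at least `c` provide. -/
theorem wide_at (L : LogPrecision) {N : ℕ} (hN : 0 < N) (h1 : c ≤ L.intRate)
    (h2 : c ≤ L.fracRate) (hc : 2 ≤ c) : Wide (L.at N) (2 ^ Nat.size N) c := by
  have hs : 1 ≤ Nat.size N := Nat.size_pos.2 hN
  have hi : Nat.size N * c ≤ L.intRate * Nat.size N := by rw [mul_comm]; gcongr
  have hf : Nat.size N * 2 ≤ L.fracRate * Nat.size N := by
    rw [mul_comm]
    exact Nat.mul_le_mul_right _ (by omega)
  refine ⟨?_, ?_, ?_, ?_⟩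
  · calc 2 = 2 ^ 1 := rfl
      _ ≤ 2 ^ Nat.size N := Nat.pow_le_pow_right (by omega) hs
  · rw [← pow_mul]
    exact Nat.pow_le_pow_right (by omega) (by simp only [LogPrecision.at]; omega)
  · exact pow_dvd_pow 2 (by simp only [LogPrecision.at]; omega)
  · rw [← pow_mul]
    exact Nat.pow_le_pow_right (by omega) (by simp only [LogPrecision.at]; omega)

/-- The alphabet has more than `J` letters and at least `size * (n + 1)` bounds the precision
parameter from below, so every nonempty word is evaluated in a wide enough arithmetic. Superfluous
letters are truncated to `J`, which neither adds nor removes solutions. -/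
theorem encoder_satisfiable (L : LogPrecision) (h1 : 17 ≤ L.intRate) (h2 : 17 ≤ L.fracRate)
    (hs : start ≤ 1) : (S.encoder n).Satisfiable start L ↔
      ∃ w : List ℕ, w ≠ [] ∧ (∀ x ∈ w, x ≤ S.J) ∧ S.Accepts n w.length fun t => w.getD t 0 := by
  have hsize : S.J < S.size * (n + 1) := by unfold size; nlinarith
  have hX (w : List (Fin (S.encoder n).alphabetSize)) (hw : w ≠ []) :=
    encoder_eval (S := S) (n := n) (start := start)
      (wide_at (c := 17) L (N := max (S.encoder n).alphabetSize w.length)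
        (lt_max_of_lt_right (List.length_pos_iff.2 hw)) h1 h2 (by omega)) (by omega)
      ((le_max_left _ _).trans_lt (Nat.lt_size_self _)) hs w hw
      ((le_max_right _ _).trans_lt (Nat.lt_size_self _))
  constructor
  · rintro ⟨w, hw, he⟩
    have := (hX w hw).1 he
    refine ⟨w.map fun x => min x.val S.J, by simpa using hw, by simp, ?_⟩
    rw [List.length_map]
    convert this using 2 with t
    by_cases ht : t < w.length <;> simp [ht]
  · rintro ⟨w, hw, hJ, he⟩
    have hlt : ∀ x ∈ w, x < (S.encoder n).alphabetSize := fun x hx => (hJ x hx).trans_lt hsize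
    refine ⟨w.pmap (fun x hx => (⟨x, hx⟩ : Fin (S.encoder n).alphabetSize)) hlt, by simpa using hw,
      (hX _ (by simpa using hw)).2 ?_⟩
    rw [List.length_pmap]
    convert he using 2 with t
    by_cases ht : t < w.length
    · simp [ht, hJ]
    · simp [ht]

end System

/-! ### The encoder as a primitive recursive function of the input -/

theorem primrec_intCast : Primrec fun n : ℕ => (n : ℤ) := by
  rw [← Primrec.encode_iff]
  refine (Primrec.nat_mul.comp (.const 2) .id).of_eq fun n => ?_
  rfl

/-- Codes of integers interleave the signs: `n` has the code `2 * n` and `-(n + 1)` has the code `2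
* n + 1`. -/
theorem primrec_neg_intCast_succ : Primrec fun n : ℕ => -((n + 1 : ℕ) : ℤ) := by
  rw [← Primrec.encode_iff]
  refine (Primrec.succ.comp (Primrec.nat_mul.comp (.const 2) .id)).of_eq fun n => ?_
  rfl

theorem primrec_range_map {α β : Type*} [Primcodable α] [Primcodable β] (d : ℕ) {f : α → ℕ → β}
    (hf : ∀ j < d, Primrec fun a => f a j) : Primrec fun a => (List.range d).map (f a) := by
  induction d with
  | zero => exact Primrec.const []
  | succ d ih =>
    refine (Primrec.list_concat.comp (ih fun j hj => hf j (by omega)) (hf d (by omega))).of_eq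
      fun a => ?_
    simp [List.range_succ]

theorem primrec_neuron {α : Type*} [Primcodable α] (d : ℕ) (b : ℤ) {w : α → ℕ → ℤ}
    (hw : ∀ j < d, Primrec fun a => w a j) : Primrec fun a => neuron d b (w a) :=
  .pair (.const _) (primrec_range_map d fun j hj => .pair (hw j hj) (.const 0))

theorem primrec_oneHidden {α : Type*} [Primcodable α] (d h o : ℕ) (b : ℕ → ℤ)
    {w : α → ℕ → ℕ → ℤ} (b' : ℕ → ℤ) (w' : ℕ → ℕ → ℤ)
    (hw : ∀ i < h, ∀ j < d, Primrec fun a => w a i j) :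
    Primrec fun a => oneHidden d h o b (w a) b' w' := by
  have h1 : Primrec fun a => [(List.range h).map fun i => neuron d (b i) (w a i)] :=
    Primrec.list_cons.comp (primrec_range_map h fun i hi => primrec_neuron d (b i) (hw i hi))
      (.const [])
  exact (Primrec.of_equiv_symm (e := FNN.equivProd)).comp
    (Primrec.pair h1 (.const ((List.range o).map fun i => neuron h (b' i) (w' i))))

theorem primrec_layer {α : Type*} [Primcodable α] (hs : List Head) {N : α → FNN} (hN : Primrec N) :
    Primrec fun a => (⟨hs, N a⟩ : Layer) :=
  (Primrec.of_equiv_symm (e := Layer.equivProd)).comp (Primrec.pair (.const hs) hN)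

namespace System

variable (S : System)

/-- For a fixed system all dimensions are constants, and a single weight depends on `n`. -/
theorem primrec_lookup : Primrec S.lookup := by
  refine primrec_oneHidden _ _ _ _ _ _ fun i _ j _ => ?_
  unfold inputWeight
  by_cases hi : i = 0
  · by_cases hj : j = 0
    · simpa only [hi, hj, if_true, unit] using primrec_intCast
    · simpa only [hi, hj, if_true, if_false, unit] using .const _
  · simpa only [hi, if_false] using .const _

theorem primrec_errorNet : Primrec S.errorNet := by
  refine primrec_oneHidden _ _ _ _ _ _ fun i _ j _ => ?_
  unfold errorWeight
  by_cases hi : i < S.R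
  · simp only [hi, if_true]
    by_cases hj : j = 3 + S.R + i
    · have h1 : j ≠ S.dim + i := by unfold dim; omega
      simp only [unit, hj, if_true]
      rw [← hj]
      simp only [h1, if_false, zero_add]
      have hs : 0 < S.size := by unfold size; omega
      -- The weight `-(size * (n + 1))` is brought into the form `-(k + 1)`, for which primitive
      -- recursiveness is known.
      have : Primrec fun n : ℕ => S.size * (n + 1) - 1 :=
        Primrec.nat_sub.comp (Primrec.nat_mul.comp (.const _) .succ) (.const 1)
      refine (primrec_neg_intCast_succ.comp this).of_eq fun n => ?_
      rw [Nat.sub_add_cancel (Nat.mul_pos hs n.succ_pos)]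
    · simp only [unit, hj, if_false]
      exact .const _
  · simp only [hi, if_false]
    exact .const _

theorem primrec_encoder : Primrec S.encoder := by
  have h1 : Primrec fun n => [S.lookupLayer n, S.errorLayer n, verdictLayer] :=
    Primrec.list_cons.comp (primrec_layer _ S.primrec_lookup)
      (Primrec.list_cons.comp (primrec_layer _ S.primrec_errorNet) (.const [verdictLayer]))
  exact (Primrec.of_equiv_symm (e := TE.equivProd)).comp
    (Primrec.pair (Primrec.nat_mul.comp (.const _) .succ) (Primrec.pair h1 (.const _)))

end System
end TransformerSat

/-! ## Closure properties of regular languages -/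

namespace Language

open scoped Computability

variable {α : Type*} {L M : Language α}

/-- By Myhill–Nerode it suffices that there are finitely many left quotients; here there are at most
three. The same criterion is used for products and stars. -/
theorem isRegular_singleton (a : α) : ({[a]} : Language α).IsRegular := by
  refine .of_finite_range_leftQuotient
    ((Set.toFinite ({{[a]}, 1, 0} : Set (Language α))).subset ?_)
  rintro _ ⟨w, rfl⟩
  have hmem : ∀ y, y ∈ ({[a]} : Language α).leftQuotient w ↔ w ++ y = [a] := fun y => Iff.rfl
  rcases w with _ | ⟨c, w⟩
  · exact .inl rfl
  · by_cases h : c = a ∧ w = []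
    · refine .inr (.inl (Language.ext fun y => ?_))
      rw [hmem, Language.mem_one, h.1, h.2]
      simp
    · refine .inr (.inr (Language.ext fun y => ?_))
      rw [hmem, List.cons_append, List.cons.injEq, List.append_eq_nil_iff]
      simp only [notMem_zero, iff_false]
      tauto

/-- The quotient of `L * M` by `w` is `(w \ L) * M` together with the quotients of `M` by those
suffixes of `w` whose complementary prefix lies in `L`. It is determined by one quotient of `L` and
a set of quotients of `M`, for which there are finitely many choices. -/
theorem IsRegular.mul (hL : L.IsRegular) (hM : M.IsRegular) : (L * M).IsRegular := by
  refine .of_finite_range_leftQuotient ((Set.Finite.image2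
    (fun (A : Language α) (Q : Set (Language α)) => A * M + ⨆ q : Q, (q : Language α))
    hL.finite_range_leftQuotient hM.finite_range_leftQuotient.powerset).subset ?_)
  rintro _ ⟨w, rfl⟩
  refine ⟨L.leftQuotient w, ⟨w, rfl⟩, {q | ∃ u v, u ++ v = w ∧ u ∈ L ∧ q = M.leftQuotient v}, ?_,
    Language.ext fun y => ?_⟩
  · rintro _ ⟨u, v, -, -, rfl⟩
    exact ⟨v, rfl⟩
  · rw [mem_add, mem_leftQuotient, mem_mul, mem_mul, mem_iSup]
    constructor
    · rintro (⟨u, hu, v, hv, rfl⟩ | ⟨⟨_, u, v, rfl, hu, rfl⟩, hy⟩)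
      · exact ⟨w ++ u, hu, v, hv, by simp⟩
      · exact ⟨u, hu, v ++ y, hy, by simp⟩
    · rintro ⟨u, hu, v, hv, h⟩
      rcases List.append_eq_append_iff.1 h with ⟨c, rfl, rfl⟩ | ⟨c, rfl, rfl⟩
      · exact .inr ⟨⟨_, u, c, rfl, hu, rfl⟩, hv⟩
      · exact .inl ⟨c, hu, v, hv, rfl⟩

/-- In a factorisation of `w ++ y`, the prefix `u` collects the complete factors before the one at
the boundary, and `v` is the part of that factor inside `w`. -/
theorem append_mem_kstar_iff (w y : List α) : w ++ y ∈ L∗ ↔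
    (w = [] ∧ y ∈ L∗) ∨ ∃ u v, u ++ v = w ∧ u ∈ L∗ ∧ y ∈ L.leftQuotient v * L∗ := by
  have happ : ∀ {u v}, u ∈ L∗ → v ∈ L∗ → u ++ v ∈ L∗ := by
    rintro _ _ ⟨l, rfl, hl⟩ ⟨l', rfl, hl'⟩
    refine ⟨l ++ l', by simp, fun z hz => ?_⟩
    rcases List.mem_append.1 hz with h | h
    exacts [hl z h, hl' z h]
  have hsub : ∀ {u}, u ∈ L → u ∈ L∗ := fun {u} hu => ⟨[u], by simp, by simpa using hu⟩
  constructor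
  · rintro ⟨l, hl, hL⟩
    induction l generalizing w with
    | nil =>
      obtain ⟨rfl, rfl⟩ := List.append_eq_nil_iff.1 hl
      exact .inl ⟨rfl, nil_mem_kstar L⟩
    | cons p l ih =>
      rw [List.flatten_cons] at hl
      have hp := hL p (by simp)
      rcases List.append_eq_append_iff.1 hl.symm with ⟨c, hwc, hc⟩ | ⟨c, rfl, rfl⟩
      · subst hwc
        rcases ih c hc.symm (fun z hz => hL z (by simp [hz])) with
          ⟨rfl, hy⟩ | ⟨u, v, rfl, hu, hy⟩
        · refine .inr ⟨[], p, by simp, nil_mem_kstar L, ?_⟩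
          exact append_mem_mul (a := []) (by simpa using hp) hy
        · exact .inr ⟨p ++ u, v, by simp, happ (hsub hp) hu, hy⟩
      · exact .inr ⟨[], w, rfl, nil_mem_kstar L,
          append_mem_mul hp ⟨l, rfl, fun z hz => hL z (by simp [hz])⟩⟩
  · rintro (⟨rfl, hy⟩ | ⟨u, v, rfl, hu, hy⟩)
    · exact hy
    · obtain ⟨c, hc, d, hd, rfl⟩ := hy
      have := happ hu (happ (hsub hc) hd)
      simpa using this

theorem IsRegular.kstar (hL : L.IsRegular) : (L∗).IsRegular := by
  refine .of_finite_range_leftQuotient (((Set.Finite.image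
    (fun (Q : Set (Language α)) => ({y | ∃ q ∈ Q, y ∈ q * L∗} : Language α))
    hL.finite_range_leftQuotient.powerset).union (Set.finite_singleton (L∗))).subset ?_)
  rintro _ ⟨w, rfl⟩
  by_cases hw : w = []
  · exact .inr (by rw [hw]; rfl)
  · refine .inl ⟨{q | ∃ u v, u ++ v = w ∧ u ∈ L∗ ∧ q = L.leftQuotient v}, ?_,
      Language.ext fun y => ?_⟩
    · rintro _ ⟨u, v, -, -, rfl⟩
      exact ⟨v, rfl⟩
    · rw [mem_leftQuotient, append_mem_kstar_iff]
      simp only [hw, false_and, false_or]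
      constructor
      · rintro ⟨_, ⟨u, v, h, hu, rfl⟩, hy⟩
        exact ⟨u, v, h, hu, hy⟩
      · rintro ⟨u, v, h, hu, hy⟩
        exact ⟨_, ⟨u, v, h, hu, rfl⟩, hy⟩

end Language

namespace TransformerSat

/-! ## Nondeterministic register programs -/

/-- The value of a linear form with coefficients and registers `l`. -/
def linear (l : List (ℤ × ℕ)) (σ : ℕ → ℤ) : ℤ := (l.map fun p => p.1 * σ p.2).sum

/-- The instructions of register machines. -/
inductive Atom
  | inc (r : ℕ)
  | dec (r : ℕ)
  | test (l : List (ℤ × ℕ)) (c : ℤ)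

def Atom.Step : Atom → (ℕ → ℕ) → (ℕ → ℕ) → Prop
  | inc r, σ, τ => τ = Function.update σ r (σ r + 1)
  | dec r, σ, τ => σ r ≠ 0 ∧ τ = Function.update σ r (σ r - 1)
  | test l c, σ, τ => linear l (fun r => σ r) + c = 0 ∧ τ = σ

def Run : List Atom → (ℕ → ℕ) → (ℕ → ℕ) → Prop
  | [], σ, τ => τ = σ
  | a :: w, σ, τ => ∃ ρ, a.Step σ ρ ∧ Run w ρ τ

theorem run_append (v w : List Atom) (σ τ : ℕ → ℕ) :
    Run (v ++ w) σ τ ↔ ∃ ρ, Run v σ ρ ∧ Run w ρ τ := by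
  induction v generalizing σ with
  | nil => simp [Run]
  | cons a v ih =>
    simp only [List.cons_append, Run, ih]
    constructor
    · rintro ⟨ρ, h, μ, h1, h2⟩
      exact ⟨μ, ⟨ρ, h, h1⟩, h2⟩
    · rintro ⟨μ, ⟨ρ, h, h1⟩, h2⟩
      exact ⟨ρ, h, μ, h1, h2⟩

/-- The relation between register contents is computed by a program, that is by the words of a
regular language over a finite set of instructions. -/
def Realizable (R : (ℕ → ℕ) → (ℕ → ℕ) → Prop) : Prop :=
  ∃ L : Language Atom, L.IsRegular ∧ (∃ A : Set Atom, A.Finite ∧ ∀ w ∈ L, ∀ a ∈ w, a ∈ A) ∧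
    ∀ σ τ, R σ τ ↔ ∃ w ∈ L, Run w σ τ

namespace Realizable

variable {R S : (ℕ → ℕ) → (ℕ → ℕ) → Prop}

theorem congr (h : Realizable R) (hRS : ∀ σ τ, R σ τ ↔ S σ τ) : Realizable S := by
  obtain ⟨L, h1, h2, h3⟩ := h
  exact ⟨L, h1, h2, fun σ τ => (hRS σ τ).symm.trans (h3 σ τ)⟩

theorem step (a : Atom) : Realizable a.Step := by
  refine ⟨{[a]}, Language.isRegular_singleton a, ⟨{a}, Set.finite_singleton a, ?_⟩, fun σ τ => ?_⟩
  · rintro w rfl b hb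
    exact List.mem_singleton.1 hb
  · constructor
    · exact fun h => ⟨[a], rfl, τ, h, rfl⟩
    · rintro ⟨_, rfl, ρ, h, rfl⟩
      exact h

theorem comp (hR : Realizable R) (hS : Realizable S) :
    Realizable fun σ τ => ∃ ρ, R σ ρ ∧ S ρ τ := by
  obtain ⟨L, h1, ⟨A, hA, h2⟩, h3⟩ := hR
  obtain ⟨M, k1, ⟨B, hB, k2⟩, k3⟩ := hS
  refine ⟨L * M, h1.mul k1, ⟨A ∪ B, hA.union hB, ?_⟩, fun σ τ => ?_⟩
  · rintro _ ⟨u, hu, v, hv, rfl⟩ a ha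
    rcases List.mem_append.1 ha with ha | ha
    exacts [.inl (h2 u hu a ha), .inr (k2 v hv a ha)]
  · constructor
    · rintro ⟨ρ, h, k⟩
      obtain ⟨u, hu, hu'⟩ := (h3 _ _).1 h
      obtain ⟨v, hv, hv'⟩ := (k3 _ _).1 k
      exact ⟨u ++ v, Language.append_mem_mul hu hv, (run_append _ _ _ _).2 ⟨ρ, hu', hv'⟩⟩
    · rintro ⟨_, ⟨u, hu, v, hv, rfl⟩, h⟩
      obtain ⟨ρ, hu', hv'⟩ := (run_append _ _ _ _).1 h
      exact ⟨ρ, (h3 _ _).2 ⟨u, hu, hu'⟩, (k3 _ _).2 ⟨v, hv, hv'⟩⟩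

theorem or (hR : Realizable R) (hS : Realizable S) : Realizable fun σ τ => R σ τ ∨ S σ τ := by
  obtain ⟨L, h1, ⟨A, hA, h2⟩, h3⟩ := hR
  obtain ⟨M, k1, ⟨B, hB, k2⟩, k3⟩ := hS
  refine ⟨L + M, h1.add k1, ⟨A ∪ B, hA.union hB, ?_⟩, fun σ τ => ?_⟩
  · rintro u (hu | hu) a ha
    exacts [.inl (h2 u hu a ha), .inr (k2 u hu a ha)]
  · simp only [h3, k3]
    constructor
    · rintro (⟨w, hw, h⟩ | ⟨w, hw, h⟩)
      exacts [⟨w, .inl hw, h⟩, ⟨w, .inr hw, h⟩]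
    · rintro ⟨w, hw | hw, h⟩
      exacts [.inl ⟨w, hw, h⟩, .inr ⟨w, hw, h⟩]

theorem star (hR : Realizable R) : Realizable (Relation.ReflTransGen R) := by
  obtain ⟨L, h1, ⟨A, hA, h2⟩, h3⟩ := hR
  refine ⟨KStar.kstar L, h1.kstar, ⟨A, hA, ?_⟩, fun σ τ => ?_⟩
  · rintro _ ⟨l, rfl, hl⟩ a ha
    obtain ⟨w, hw, ha⟩ := List.mem_flatten.1 ha
    exact h2 w (hl w hw) a ha
  · constructor
    · intro h
      induction h using Relation.ReflTransGen.head_induction_on with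
      | refl => exact ⟨[], Language.nil_mem_kstar L, rfl⟩
      | head h _ ih =>
        obtain ⟨_, ⟨l, rfl, hl⟩, hw⟩ := ih
        obtain ⟨u, hu, hu'⟩ := (h3 _ _).1 h
        refine ⟨u ++ l.flatten, ⟨u :: l, rfl, ?_⟩, (run_append _ _ _ _).2 ⟨_, hu', hw⟩⟩
        intro z hz
        rcases List.mem_cons.1 hz with rfl | hz
        exacts [hu, hl z hz]
    · rintro ⟨_, ⟨l, rfl, hl⟩, h⟩
      induction l generalizing σ with
      | nil =>
        rw [show τ = σ from h]
      | cons u l ih =>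
        obtain ⟨ρ, hu, hl'⟩ := (run_append _ _ _ _).1 h
        exact .head ((h3 _ _).2 ⟨u, hl u (by simp), hu⟩)
          (ih ρ (fun z hz => hl z (by simp [hz])) hl')

/-- Nondeterministic assignment: arbitrarily many increments and decrements of one register, going
down to `0` and up again, reach every value. Deterministic assignments then arise by guessing and
testing. -/
theorem havoc (r : ℕ) : Realizable fun σ τ => ∃ v, τ = Function.update σ r v := by
  refine ((step (.inc r)).or (step (.dec r))).star.congr fun σ τ => ⟨fun h => ?_, ?_⟩
  · induction h with
    | refl => exact ⟨σ r, by simp⟩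
    | tail _ h ih =>
      obtain ⟨v, rfl⟩ := ih
      rcases h with h | ⟨_, h⟩ <;> exact ⟨_, by rw [h, Function.update_idem]⟩
  · rintro ⟨v, rfl⟩
    have h1 (a : ℕ) : Relation.ReflTransGen (fun σ τ => (Atom.inc r).Step σ τ ∨
        (Atom.dec r).Step σ τ) (Function.update σ r a) (Function.update σ r 0) := by
      induction a with
      | zero => exact .refl
      | succ a ih => exact .head (.inr ⟨by simp, by simp⟩) ih
    have h2 (a : ℕ) : Relation.ReflTransGen (fun σ τ => (Atom.inc r).Step σ τ ∨
        (Atom.dec r).Step σ τ) (Function.update σ r 0) (Function.update σ r a) := by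
      induction a with
      | zero => exact .refl
      | succ a ih => exact .tail ih (.inl (by simp [Atom.Step]))
    have := h1 (σ r)
    rw [Function.update_eq_self] at this
    exact this.trans (h2 v)

theorem set_zero (r : ℕ) : Realizable fun σ τ => τ = Function.update σ r 0 := by
  refine ((havoc r).comp (step (.test [(1, r)] 0))).congr fun σ τ => ?_
  simp only [Atom.Step, linear]
  constructor
  · rintro ⟨_, ⟨v, rfl⟩, h, rfl⟩
    simp at h
    rw [h]
  · rintro rfl
    exact ⟨_, ⟨0, rfl⟩, by simp, rfl⟩

theorem set_eq {q r : ℕ} (h : q ≠ r) : Realizable fun σ τ => τ = Function.update σ r (σ q) := by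
  refine ((havoc r).comp (step (.test [(1, r), (-1, q)] 0))).congr fun σ τ => ?_
  simp only [Atom.Step, linear]
  constructor
  · rintro ⟨_, ⟨v, rfl⟩, h', rfl⟩
    simp [h] at h'
    rw [show v = σ q by omega]
  · rintro rfl
    exact ⟨_, ⟨_, rfl⟩, by simp [h], rfl⟩

end Realizable

/-! ## Definable predicates -/

/-- The predicate is decided by the halting of a program that changes nothing and that has the
registers `b, b + 1, …` as additional memory. -/
def Definable (b : ℕ) (A : (ℕ → ℕ) → Prop) : Prop :=
  ∃ R, Realizable R ∧ ∀ σ, (∀ j, b ≤ j → σ j = 0) → ∀ τ, R σ τ ↔ τ = σ ∧ A σ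

namespace Definable

variable {b : ℕ} {A B : (ℕ → ℕ) → Prop}

theorem congr (h : Definable b A) (hAB : ∀ σ, A σ ↔ B σ) : Definable b B := by
  obtain ⟨R, h1, h2⟩ := h
  exact ⟨R, h1, fun σ hσ τ => by rw [h2 σ hσ, hAB]⟩

theorem linear_eq (b : ℕ) (l : List (ℤ × ℕ)) (c : ℤ) :
    Definable b fun σ => linear l (fun r => σ r) + c = 0 :=
  ⟨_, .step (.test l c), fun _ _ _ => and_comm⟩

theorem and (hA : Definable b A) (hB : Definable b B) : Definable b fun σ => A σ ∧ B σ := by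
  obtain ⟨R, h1, h2⟩ := hA
  obtain ⟨S, k1, k2⟩ := hB
  refine ⟨_, h1.comp k1, fun σ hσ τ => ⟨?_, ?_⟩⟩
  · rintro ⟨ρ, h, k⟩
    obtain ⟨rfl, h⟩ := (h2 σ hσ ρ).1 h
    obtain ⟨rfl, k⟩ := (k2 _ hσ τ).1 k
    exact ⟨rfl, h, k⟩
  · rintro ⟨rfl, h, k⟩
    exact ⟨τ, (h2 _ hσ _).2 ⟨rfl, h⟩, (k2 _ hσ _).2 ⟨rfl, k⟩⟩

theorem or (hA : Definable b A) (hB : Definable b B) : Definable b fun σ => A σ ∨ B σ := by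
  obtain ⟨R, h1, h2⟩ := hA
  obtain ⟨S, k1, k2⟩ := hB
  exact ⟨_, h1.or k1, fun σ hσ τ => by rw [h2 σ hσ, k2 σ hσ, and_or_left]⟩

/-- The witness is guessed in the first free register, which is cleared afterwards because
definability demands unchanged registers. -/
theorem ex (hA : Definable (b + 1) A) :
    Definable b fun σ => ∃ v, A (Function.update σ b v) := by
  obtain ⟨R, h1, h2⟩ := hA
  refine ⟨_, ((Realizable.havoc b).comp h1).comp (.set_zero b), fun σ hσ τ => ?_⟩
  have hz (v : ℕ) : ∀ j, b + 1 ≤ j → Function.update σ b v j = 0 := fun j hj => by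
    rw [Function.update_of_ne (by omega)]
    exact hσ j (by omega)
  have h0 (v : ℕ) : Function.update (Function.update σ b v) b 0 = σ := by
    rw [Function.update_idem, ← hσ b le_rfl, Function.update_eq_self]
  constructor
  · rintro ⟨ρ, ⟨_, ⟨v, rfl⟩, h⟩, rfl⟩
    obtain ⟨rfl, hA⟩ := (h2 _ (hz v) ρ).1 h
    exact ⟨h0 v, v, hA⟩
  · rintro ⟨rfl, v, h⟩
    exact ⟨_, ⟨_, ⟨v, rfl⟩, (h2 _ (hz v) _).2 ⟨rfl, h⟩⟩, (h0 v).symm⟩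

end Definable

/-- Iteration of the relation `P i` from `s₀`, where `i` counts the steps. -/
def Iter (P : ℕ → ℕ → ℕ → Prop) (s₀ : ℕ) : ℕ → ℕ → Prop
  | 0, s => s = s₀
  | n + 1, s' => ∃ s, Iter P s₀ n s ∧ P n s s'

/-- A loop with the state in `b`, the step counter in `b + 1` and the next state in `b + 2`. It may
stop after any number of passes; tests at the end select the runs with the right counter and state.
-/
theorem Definable.iter {b x y z : ℕ} {A : (ℕ → ℕ) → Prop} (hA : Definable (b + 3) A) (hx : x < b)
    (hy : y < b) (hz : z < b) : Definable b fun σ => Iter (fun i s s' =>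
      A (Function.update (Function.update (Function.update σ b s) (b + 1) i) (b + 2) s'))
      (σ x) (σ y) (σ z) := by
  obtain ⟨R, h1, h2⟩ := hA
  -- One pass: guess the next state, check the transition, make it the current state, clear the
  -- auxiliary register and count.
  have hb := (((((Realizable.havoc (b + 2)).comp h1).comp
    (Realizable.set_eq (by omega : b + 2 ≠ b))).comp (.set_zero (b + 2))).comp
    (.step (.inc (b + 1)))).congr (S := fun σ τ => ∃ v ρ, R (Function.update σ (b + 2) v) ρ ∧
      τ = Function.update (Function.update (Function.update ρ b (ρ (b + 2))) (b + 2) 0) (b + 1)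
        (ρ (b + 1) + 1)) fun σ τ => by
    constructor
    · rintro ⟨_, ⟨_, ⟨ρ, ⟨_, ⟨v, rfl⟩, h⟩, rfl⟩, rfl⟩, rfl⟩
      exact ⟨v, ρ, h, by simp⟩
    · rintro ⟨v, ρ, h, rfl⟩
      exact ⟨_, ⟨_, ⟨ρ, ⟨_, ⟨v, rfl⟩, h⟩, rfl⟩, rfl⟩, by simp [Atom.Step]⟩
  refine ⟨_, (((((Realizable.set_eq (by omega : x ≠ b)).comp hb.star).comp
    (.step (.test [(1, b), (-1, z)] 0))).comp (.step (.test [(1, b + 1), (-1, y)] 0))).comp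
    (.set_zero b)).comp (.set_zero (b + 1)), fun σ hσ τ => ?_⟩
  set P := fun i s s' =>
    A (Function.update (Function.update (Function.update σ b s) (b + 1) i) (b + 2) s') with hP
  set st : ℕ → ℕ → ℕ → ℕ := fun s i => Function.update (Function.update σ b s) (b + 1) i with hst
  have hstb (s i) : st s i b = s := by simp [hst]
  have hsti (s i) : st s i (b + 1) = i := by simp [hst]
  have hsto (s i j) (hj : j < b) : st s i j = σ j := by
    simp only [hst]
    rw [Function.update_of_ne (by omega), Function.update_of_ne (by omega)]
  have hst3 (s i s') : ∀ j, b + 3 ≤ j → Function.update (st s i) (b + 2) s' j = 0 := fun j hj => by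
    simp only [hst]
    rw [Function.update_of_ne (by omega), Function.update_of_ne (by omega),
      Function.update_of_ne (by omega), hσ j (by omega)]
  have hupd (s i s') : Function.update (Function.update (Function.update (Function.update (st s i)
      (b + 2) s') b s') (b + 2) 0) (b + 1) (i + 1) = st s' (i + 1) := by
    funext j
    simp only [hst, Function.update_apply]
    split_ifs <;> first | rfl | omega | exact (hσ _ (by omega)).symm
  have hbody (s i τ) : (∃ v ρ, R (Function.update (st s i) (b + 2) v) ρ ∧
      τ = Function.update (Function.update (Function.update ρ b (ρ (b + 2))) (b + 2) 0) (b + 1)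
        (ρ (b + 1) + 1)) ↔ ∃ s', P i s s' ∧ τ = st s' (i + 1) := by
    refine exists_congr fun v => ?_
    have e1 : Function.update (st s i) (b + 2) v (b + 2) = v := by simp
    have e2 : Function.update (st s i) (b + 2) v (b + 1) = i := by
      rw [Function.update_of_ne (by omega), hsti]
    constructor
    · rintro ⟨ρ, h, rfl⟩
      obtain ⟨rfl, hA⟩ := (h2 _ (hst3 s i v) ρ).1 h
      exact ⟨hA, by rw [e1, e2, hupd]⟩
    · rintro ⟨h, rfl⟩
      exact ⟨_, (h2 _ (hst3 s i v) _).2 ⟨rfl, h⟩, by rw [e1, e2, hupd]⟩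
  set body := fun σ τ => ∃ v ρ, R (Function.update σ (b + 2) v) ρ ∧
    τ = Function.update (Function.update (Function.update ρ b (ρ (b + 2))) (b + 2) 0) (b + 1)
      (ρ (b + 1) + 1)
  have hloop (s₀ τ) : Relation.ReflTransGen body (st s₀ 0) τ ↔
      ∃ n s, Iter P s₀ n s ∧ τ = st s n := by
    constructor
    · intro h
      induction h with
      | refl => exact ⟨0, s₀, rfl, rfl⟩
      | tail _ h ih =>
        obtain ⟨n, s, hi, rfl⟩ := ih
        obtain ⟨s', hs', rfl⟩ := (hbody _ _ _).1 h
        exact ⟨n + 1, s', ⟨s, hi, hs'⟩, rfl⟩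
    · rintro ⟨n, s, hi, rfl⟩
      induction n generalizing s with
      | zero =>
        rw [show s = s₀ from hi]
      | succ n ih =>
        obtain ⟨s₁, h1, h2⟩ := hi
        exact (ih s₁ h1).tail ((hbody _ _ _).2 ⟨s, h2, rfl⟩)
  have hinit (v : ℕ) : Function.update σ b v = st v 0 := by
    funext j
    simp only [hst, Function.update_apply]
    split_ifs with h1 h2 <;> first | rfl | omega | exact hσ _ (by omega)
  have hfin (s i : ℕ) : Function.update (Function.update (st s i) b 0) (b + 1) 0 = σ := by
    funext j
    simp only [hst, Function.update_apply]
    split_ifs <;> first | rfl | exact (hσ _ (by omega)).symm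
  simp only [Atom.Step, linear]
  constructor
  · rintro ⟨_, ⟨_, ⟨_, ⟨ρ, ⟨_, rfl, h⟩, hz', rfl⟩, hy', rfl⟩, rfl⟩, rfl⟩
    rw [hinit, hloop] at h
    obtain ⟨n, s, hi, rfl⟩ := h
    refine ⟨hfin s n, ?_⟩
    simp [hstb, hsti, hsto _ _ _ hy, hsto _ _ _ hz] at hy' hz'
    rwa [show σ y = n by omega, show σ z = s by omega]
  · rintro ⟨rfl, h⟩
    refine ⟨_, ⟨_, ⟨_, ⟨st (τ z) (τ y), ⟨_, rfl, ?_⟩, ?_, rfl⟩, ?_, rfl⟩, rfl⟩, (hfin _ _).symm⟩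
    · rw [hinit, hloop]
      exact ⟨_, _, h, rfl⟩
    · simp [hstb, hsto _ _ _ hz]
    · simp [hsti, hsto _ _ _ hy]

/-! ## Graphs of partial recursive functions are definable -/

namespace Definable

variable {b x y z : ℕ}

theorem eq_zero (b x : ℕ) : Definable b fun σ => σ x = 0 :=
  (linear_eq b [(1, x)] 0).congr fun σ => by simp [linear]

theorem eq (b x y : ℕ) : Definable b fun σ => σ x = σ y :=
  (linear_eq b [(1, x), (-1, y)] 0).congr fun σ => by simp [linear]; omega

/-- Multiplication is repeated addition of `σ x`, iterated `σ y` times from a register `b` that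
contains `0`. -/
theorem eq_mul (hx : x < b) (hy : y < b) (hz : z < b) :
    Definable b fun σ => σ z = σ x * σ y := by
  have hA : Definable (b + 4) fun σ => σ (b + 3) = σ (b + 1) + σ x :=
    (linear_eq _ [(1, b + 3), (-1, b + 1), (-1, x)] 0).congr fun σ => by
      simp [linear]
      omega
  have hI := hA.iter (b := b + 1) (x := b) (y := y) (z := z) (by omega) (by omega) (by omega)
  have key (a n s : ℕ) : Iter (fun _ s s' => s' = s + a) 0 n s ↔ s = a * n := by
    induction n generalizing s with
    | zero => simp [Iter]
    | succ n ih => simp [Iter, ih, mul_add]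
  refine ((eq_zero (b + 1) b).and hI).ex.congr fun σ => ?_
  simp (disch := omega) only [Function.update_of_ne, Function.update_self]
  simp [key]

theorem ne_zero (hx : x < b) : Definable b fun σ => σ x ≠ 0 := by
  have h : Definable (b + 1) fun σ => σ x = σ b + 1 :=
    (linear_eq _ [(1, x), (-1, b)] (-1)).congr fun σ => by simp [linear]; omega
  refine h.ex.congr fun σ => ?_
  simp (disch := omega) only [Function.update_of_ne, Function.update_self]
  exact Nat.exists_eq_add_one.trans Nat.pos_iff_ne_zero

/-- The two cases of `Nat.pair` are told apart by a guessed slack `d`, which turns the comparison of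
`σ x` and `σ y` into an equation; `q` holds the square. -/
theorem eq_pair (hx : x < b) (hy : y < b) (hz : z < b) :
    Definable b fun σ => σ z = Nat.pair (σ x) (σ y) := by
  have h1 : Definable b fun σ => ∃ d q, σ y = σ x + d + 1 ∧ q = σ y * σ y ∧ σ z = q + σ x := by
    have e1 : Definable (b + 2) fun σ => σ y = σ x + σ b + 1 :=
      (linear_eq _ [(1, y), (-1, x), (-1, b)] (-1)).congr fun σ => by simp [linear]; omega
    have e2 : Definable (b + 2) fun σ => σ (b + 1) = σ y * σ y :=
      eq_mul (by omega) (by omega) (by omega)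
    have e3 : Definable (b + 2) fun σ => σ z = σ (b + 1) + σ x :=
      (linear_eq _ [(1, z), (-1, b + 1), (-1, x)] 0).congr fun σ => by simp [linear]; omega
    refine (e1.and (e2.and e3)).ex.ex.congr fun σ => ?_
    simp (disch := omega) only [Function.update_of_ne, Function.update_self]
  have h2 : Definable b fun σ => ∃ d q, σ x = σ y + d ∧ q = σ x * σ x ∧ σ z = q + σ x + σ y := by
    have e1 : Definable (b + 2) fun σ => σ x = σ y + σ b :=
      (linear_eq _ [(1, x), (-1, y), (-1, b)] 0).congr fun σ => by simp [linear]; omega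
    have e2 : Definable (b + 2) fun σ => σ (b + 1) = σ x * σ x :=
      eq_mul (by omega) (by omega) (by omega)
    have e3 : Definable (b + 2) fun σ => σ z = σ (b + 1) + σ x + σ y :=
      (linear_eq _ [(1, z), (-1, b + 1), (-1, x), (-1, y)] 0).congr fun σ => by
        simp [linear]
        omega
    refine (e1.and (e2.and e3)).ex.ex.congr fun σ => ?_
    simp (disch := omega) only [Function.update_of_ne, Function.update_self]
  refine (h1.or h2).congr fun σ => ?_
  unfold Nat.pair
  constructor
  · rintro (⟨d, q, h, rfl, hz⟩ | ⟨d, q, h, rfl, hz⟩)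
    · rw [if_pos (by omega), hz]
    · rw [if_neg (by omega), hz]
  · intro h
    split_ifs at h with hlt
    · exact .inl ⟨σ y - σ x - 1, _, by omega, rfl, h⟩
    · exact .inr ⟨σ x - σ y, _, by omega, rfl, h⟩

end Definable

/-- The graph of the partial function is definable, for all choices of registers for the argument
and for the value. -/
def DefinableGraph (f : ℕ →. ℕ) : Prop :=
  ∀ b x y, x < b → y < b → Definable b fun σ => σ y ∈ f (σ x)

theorem mem_prec_iff (f g : ℕ →. ℕ) (a n y : ℕ) :
    y ∈ (Nat.rec (f a) (fun i IH => IH.bind fun s => g (Nat.pair a (Nat.pair i s))) n : Part ℕ) ↔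
      ∃ s₀ ∈ f a, Iter (fun i s s' => s' ∈ g (Nat.pair a (Nat.pair i s))) s₀ n y := by
  induction n generalizing y with
  | zero => simp [Iter]
  | succ n ih =>
    simp only [Part.mem_bind_iff, ih, Iter]
    constructor
    · rintro ⟨s, ⟨s₀, h0, h1⟩, h2⟩
      exact ⟨s₀, h0, s, h1, h2⟩
    · rintro ⟨s₀, h0, s, h1, h2⟩
      exact ⟨s, ⟨s₀, h0, h1⟩, h2⟩

/-- An iteration that never changes its state but checks a condition on the counter is a bounded
universal quantifier. Minimisation needs this. -/
theorem iter_const_iff (Q : ℕ → Prop) (s₀ n s : ℕ) :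
    Iter (fun i s s' => s' = s ∧ Q i) s₀ n s ↔ s = s₀ ∧ ∀ m < n, Q m := by
  induction n generalizing s with
  | zero => simp [Iter]
  | succ n ih =>
    simp only [Iter, ih, Nat.forall_lt_succ_right]
    constructor
    · rintro ⟨_, ⟨rfl, h⟩, rfl, h'⟩
      exact ⟨rfl, h, h'⟩
    · rintro ⟨rfl, h, h'⟩
      exact ⟨_, ⟨rfl, h⟩, rfl, h'⟩

/-- Induction over the construction of partial recursive functions: composition and pairing use
existential quantifiers, primitive recursion uses `Definable.iter`, and minimisation uses an
iteration with constant state. -/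
theorem definableGraph {f : ℕ →. ℕ} (hf : Nat.Partrec f) : DefinableGraph f := by
  induction hf with
  | zero =>
    intro b x y hx hy
    refine (Definable.linear_eq b [(1, y)] 0).congr fun σ => ?_
    change _ ↔ σ y ∈ Part.some 0
    simp [linear]
  | succ =>
    intro b x y hx hy
    refine (Definable.linear_eq b [(1, y), (-1, x)] (-1)).congr fun σ => ?_
    simp [linear]
    omega
  | left =>
    intro b x y hx hy
    refine (Definable.eq_pair (b := b + 1) (x := y) (y := b) (z := x) (by omega) (by omega)
      (by omega)).ex.congr fun σ => ?_
    simp (disch := omega) only [Function.update_of_ne, Function.update_self,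
      PFun.coe_val, Part.mem_some_iff]
    constructor
    · rintro ⟨v, h⟩
      rw [h, Nat.unpair_pair]
    · intro h
      exact ⟨(σ x).unpair.2, by rw [h, Nat.pair_unpair]⟩
  | right =>
    intro b x y hx hy
    refine (Definable.eq_pair (b := b + 1) (x := b) (y := y) (z := x) (by omega) (by omega)
      (by omega)).ex.congr fun σ => ?_
    simp (disch := omega) only [Function.update_of_ne, Function.update_self,
      PFun.coe_val, Part.mem_some_iff]
    constructor
    · rintro ⟨v, h⟩
      rw [h, Nat.unpair_pair]
    · intro h
      exact ⟨(σ x).unpair.1, by rw [h, Nat.pair_unpair]⟩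
  | pair _ _ ihf ihg =>
    intro b x y hx hy
    refine ((ihf (b + 2) x b (by omega) (by omega)).and
      ((ihg (b + 2) x (b + 1) (by omega) (by omega)).and
        (Definable.eq_pair (b := b + 2) (x := b) (y := b + 1) (z := y) (by omega) (by omega)
          (by omega)))).ex.ex.congr fun σ => ?_
    simp (disch := omega) only [Function.update_of_ne, Function.update_self]
    simp [Seq.seq, eq_comm]
  | comp _ _ ihf ihg =>
    intro b x y hx hy
    refine ((ihg (b + 1) x b (by omega) (by omega)).and
      (ihf (b + 1) b y (by omega) (by omega))).ex.congr fun σ => ?_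
    simp (disch := omega) only [Function.update_of_ne, Function.update_self]
    exact Part.mem_bind_iff.symm
  | @prec f g _ _ ihf ihg =>
    intro b x y hx hy
    have h1 := Definable.eq_pair (b := b + 3) (x := b) (y := b + 1) (z := x) (by omega) (by omega)
      (by omega)
    have h2 := ihf (b + 3) b (b + 2) (by omega) (by omega)
    -- Registers: `b` is the parameter, `b + 1` the number of steps and `b + 2` the initial value.
    -- State, counter and next state of the loop are in `b + 3`, `b + 4`, `b + 5`; the other two
    -- hold the nested pairs for the argument of `g`.
    have h3 := ((Definable.eq_pair (b := b + 8) (x := b + 4) (y := b + 3) (z := b + 6) (by omega)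
      (by omega) (by omega)).and ((Definable.eq_pair (b := b + 8) (x := b) (y := b + 6) (z := b + 7)
      (by omega) (by omega) (by omega)).and (ihg (b + 8) (b + 7) (b + 5) (by omega)
      (by omega)))).ex.ex.iter (x := b + 2) (y := b + 1) (z := y) (by omega) (by omega) (by omega)
    refine (h1.and (h2.and h3)).ex.ex.ex.congr fun σ => ?_
    simp (disch := omega) only [Function.update_of_ne, Function.update_self]
    simp only [exists_and_left, exists_eq_left, Nat.unpaired]
    refine Iff.trans ?_ (mem_prec_iff f g _ _ _).symm
    constructor
    · rintro ⟨a, n, h, s₀, h0, hI⟩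
      rw [h, Nat.unpair_pair]
      exact ⟨s₀, h0, hI⟩
    · rintro ⟨s₀, h0, hI⟩
      exact ⟨_, _, (Nat.pair_unpair _).symm, s₀, h0, hI⟩
  | @rfind f _ ihf =>
    intro b x y hx hy
    have h1 := (Definable.eq_pair (b := b + 2) (x := x) (y := y) (z := b) (by omega) (by omega)
      (by omega)).and ((ihf (b + 2) b (b + 1) (by omega) (by omega)).and
        (Definable.eq_zero (b + 2) (b + 1)))
    -- The loop starts and ends with the content of `b + 1` and keeps it as its state. At each
    -- counter value below `σ y` it checks that `f` has a nonzero value.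
    have h2 := ((Definable.eq (b + 7) (b + 4) (b + 2)).and
      ((Definable.eq_pair (b := b + 7) (x := x) (y := b + 3) (z := b + 5) (by omega)
      (by omega) (by omega)).and ((ihf (b + 7) (b + 5) (b + 6) (by omega) (by omega)).and
      (Definable.ne_zero (by omega : b + 6 < b + 7))))).ex.ex.iter
        (b := b + 2) (x := b + 1) (y := y) (z := b + 1) (by omega) (by omega) (by omega)
    refine ((h1.and h2).ex.ex).congr fun σ => ?_
    simp (disch := omega) only [Function.update_of_ne, Function.update_self]
    simp only [exists_and_left, exists_eq_left, iter_const_iff]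
    refine Iff.trans ?_ Nat.mem_rfind.symm
    have hmem (c : Bool) (n : ℕ) : c ∈ (fun m => decide (m = 0)) <$> f (Nat.pair (σ x) n) ↔
        ∃ v ∈ f (Nat.pair (σ x) n), decide (v = 0) = c := by
      rw [Part.map_eq_map, Part.mem_map_iff]
    constructor
    · rintro ⟨_, _, ⟨rfl, h1, rfl⟩, -, h2⟩
      refine ⟨(hmem _ _).2 ⟨0, h1, rfl⟩, fun {m} hm => (hmem _ _).2 ?_⟩
      obtain ⟨v, hv, hv0⟩ := h2 m hm
      exact ⟨v, hv, by simpa using hv0⟩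
    · rintro ⟨h1, h2⟩
      obtain ⟨v, hv, hv0⟩ := (hmem _ _).1 h1
      refine ⟨_, v, ⟨rfl, hv, by simpa using hv0⟩, trivial, fun m hm => ?_⟩
      obtain ⟨v, hv, hv0⟩ := (hmem _ _).1 (h2 hm)
      exact ⟨v, hv, by simpa using hv0⟩

/-! ## From programs to systems of inequalities -/

/-- The word satisfies all inequalities, when the left-hand sides start with the values `s`. -/
def Valid {ι Λ : Type*} (step : ι → Λ → ℤ) (closed : ι → Λ → Bool) : (ι → ℤ) → List Λ → Prop
  | _, [] => True
  | s, a :: w => (∀ i, closed i a = false → 0 ≤ s i + step i a) ∧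
      Valid step closed (fun i => s i + step i a) w

theorem valid_iff {ι Λ : Type*} (step : ι → Λ → ℤ) (closed : ι → Λ → Bool) (d : Λ) (w : List Λ)
    (s : ι → ℤ) : Valid step closed s w ↔ ∀ m < w.length, ∀ i, closed i (w.getD m d) = false →
      0 ≤ s i + ∑ j ∈ Finset.range (m + 1), step i (w.getD j d) := by
  induction w generalizing s with
  | nil => simp [Valid]
  | cons a w ih =>
    simp only [Valid, ih, List.length_cons]
    constructor
    · rintro ⟨h0, h⟩ (_ | m) hm i hi
      · simpa using h0 i hi
      · rw [Finset.sum_range_succ']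
        have := h m (by omega) i (by simpa using hi)
        simp only [List.getD_cons_succ, List.getD_cons_zero] at this ⊢
        linarith
    · intro h
      refine ⟨fun i hi => by simpa using h 0 (by omega) i hi, fun m hm i hi => ?_⟩
      have := h (m + 1) (by omega) i (by simpa using hi)
      rw [Finset.sum_range_succ'] at this
      simp only [List.getD_cons_succ, List.getD_cons_zero] at this
      linarith

theorem exists_abs_le {ι : Type*} [Finite ι] (f : ι → ℤ) : ∃ D : ℕ, ∀ i, |f i| ≤ D := by
  obtain ⟨D, hD⟩ := (Set.finite_range fun i => |f i|).bddAbove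
  refine ⟨D.toNat, fun i => ?_⟩
  have := hD ⟨i, rfl⟩
  simp only at this
  omega

/-- Rows and letters are numbered. Numbers out of range denote arbitrary elements, so the common
bound `D` holds for all natural numbers. -/
theorem exists_system {ι Λ : Type} [Finite ι] [Nonempty ι] [Finite Λ] [Nonempty Λ]
    (step : ι → Λ → ℤ) (closed : ι → Λ → Bool) (init coeff : ι → ℤ) (bad : Λ → Bool) :
    ∃ S : System, ∀ n : ℕ, (∃ w : List ℕ, w ≠ [] ∧ (∀ x ∈ w, x ≤ S.J) ∧
        S.Accepts n w.length fun t => w.getD t 0) ↔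
      ∃ w : List Λ, w ≠ [] ∧ Valid step closed (fun i => init i + n * coeff i) w ∧
        ∀ a ∈ w.getLast?, bad a = false := by
  have := Fintype.ofFinite ι
  have := Fintype.ofFinite Λ
  have eι := Fintype.equivFin ι
  have eΛ := Fintype.equivFin Λ
  have hΛ : 0 < Fintype.card Λ := Fintype.card_pos
  obtain ⟨D1, h1⟩ := exists_abs_le fun x : ι × Λ => step x.1 x.2
  obtain ⟨D2, h2⟩ := exists_abs_le init
  obtain ⟨D3, h3⟩ := exists_abs_le coeff
  set row : ℕ → ι := fun r => if h : r < Fintype.card ι then eι.symm ⟨r, h⟩ else Classical.arbitrary ι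
    with hrow
  set letter : ℕ → Λ := fun a =>
    if h : a < Fintype.card Λ then eΛ.symm ⟨a, h⟩ else Classical.arbitrary Λ with hlet
  have hr : ∀ i, row (eι i) = i := fun i => by simp [hrow]
  have hl : ∀ a, letter (eΛ a) = a := fun a => by simp [hlet]
  have hforall : ∀ P : ι → Prop, (∀ r < Fintype.card ι, P (row r)) ↔ ∀ i, P i := fun P =>
    ⟨fun h i => hr i ▸ h _ (eι i).isLt, fun h r _ => h _⟩
  let S : System :=
    { J := Fintype.card Λ - 1
      R := Fintype.card ι
      D := D1 + D2 + D3
      step := fun r a => step (row r) (letter a)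
      closed := fun r a => closed (row r) (letter a)
      init := fun r => init (row r)
      coeff := fun r => coeff (row r)
      bad := fun a => bad (letter a)
      step_le := fun r a => (h1 (row r, letter a)).trans (by push_cast; linarith)
      init_le := fun r => (h2 (row r)).trans (by push_cast; linarith)
      coeff_le := fun r => (h3 (row r)).trans (by push_cast; linarith) }
  have key (n : ℕ) (w : List ℕ) (hw : w ≠ []) : (S.Accepts n w.length fun t => w.getD t 0) ↔
      Valid step closed (fun i => init i + n * coeff i) (w.map letter) ∧
        ∀ a ∈ (w.map letter).getLast?, bad a = false := by
    have hget (t : ℕ) : letter (w.getD t 0) = (w.map letter).getD t (letter 0) := by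
      simp [List.getD_eq_getElem?_getD, List.getElem?_map, Option.getD_map]
    rw [valid_iff step closed (letter 0)]
    unfold System.Accepts System.value
    simp only [S, hget, List.length_map]
    refine and_congr (forall₂_congr fun m _ => hforall fun i =>
      closed i ((w.map letter).getD m (letter 0)) = false → 0 ≤ init i + n * coeff i +
        ∑ j ∈ Finset.range (m + 1), step i ((w.map letter).getD j (letter 0))) ?_
    have hlen : w.length - 1 < w.length := by
      have := List.length_pos_iff.2 hw
      omega
    rw [List.getLast?_eq_getElem?, List.getD_eq_getElem?_getD, List.length_map]
    simp [List.getElem?_eq_getElem hlen]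
  refine ⟨S, fun n => ⟨?_, ?_⟩⟩
  · rintro ⟨w, hw, -, h⟩
    exact ⟨w.map letter, by simpa using hw, (key n w hw).1 h⟩
  · rintro ⟨w, hw, h⟩
    have hmap : (w.map fun a => (eΛ a : ℕ)).map letter = w := by
      rw [List.map_map]
      exact (List.map_congr_left fun a _ => hl a).trans (List.map_id w)
    refine ⟨w.map fun a => (eΛ a : ℕ), by simpa using hw, ?_, (key n _ (by simpa using hw)).2 ?_⟩
    · intro x hx
      obtain ⟨a, -, rfl⟩ := List.mem_map.1 hx
      have := (eΛ a).isLt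
      simp only [S]
      omega
    · rwa [hmap]

theorem linear_add (l : List (ℤ × ℕ)) (σ τ : ℕ → ℤ) :
    linear l (σ + τ) = linear l σ + linear l τ := by
  induction l with
  | nil => simp [linear]
  | cons p l ih =>
    simp only [linear, List.map_cons, List.sum_cons, Pi.add_apply] at *
    rw [ih]
    ring

theorem linear_mul (l : List (ℤ × ℕ)) (c : ℤ) (σ : ℕ → ℤ) :
    linear l (fun r => c * σ r) = c * linear l σ := by
  induction l with
  | nil => simp [linear]
  | cons p l ih =>
    simp only [linear, List.map_cons, List.sum_cons] at *
    rw [ih]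
    ring

namespace Atom

/-- The change of the registers. -/
def effect : Atom → ℕ → ℤ
  | inc r => Pi.single r 1
  | dec r => Pi.single r (-1)
  | test _ _ => 0

def form : Atom → List (ℤ × ℕ)
  | inc _ => []
  | dec r => [(1, r)]
  | test l _ => l

def const : Atom → ℤ
  | inc _ => 0
  | dec _ => 0
  | test _ c => c

def sign : Atom → Bool → ℤ
  | test _ _, false => -1
  | _, _ => 1

theorem Step.effect {a : Atom} {σ τ : ℕ → ℕ} (h : a.Step σ τ) :
    (fun r => (τ r : ℤ)) = (fun r => (σ r : ℤ)) + a.effect := by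
  funext q
  cases a with
  | inc r =>
    rw [show τ = _ from h]
    by_cases hq : q = r <;> simp [Atom.effect, hq]
  | dec r =>
    obtain ⟨h0, rfl⟩ := h
    by_cases hq : q = r
    · subst hq
      simp [Atom.effect]
      omega
    · simp [Atom.effect, hq]
  | test l c =>
    rw [h.2]
    simp [Atom.effect]

/-- Executability is read off the registers after the effect, since rows are evaluated with the
current letter included: a decrement is possible if the new value is nonnegative. Two signs turn the
inequality into the equation of a test. -/
theorem exists_step_iff (a : Atom) (σ : ℕ → ℕ) : (∃ τ, a.Step σ τ) ↔
    ∀ s, 0 ≤ a.sign s * (linear a.form ((fun r => (σ r : ℤ)) + a.effect) + a.const) := by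
  cases a with
  | inc r => simp [Step, linear, form, const]
  | dec r =>
    simp [Step, linear, form, const, sign, Atom.effect]
    omega
  | test l c =>
    simp [Step, form, const, sign, Atom.effect]
    omega

end Atom

section Lift

variable {Q : Type} {A : Set Atom} (M : DFA Atom Q)

/-- The run of the automaton on a word, as the list of its transitions. -/
def lift (M : DFA Atom Q) : Q → List A → List (Q × A)
  | _, [] => []
  | p, a :: x => (p, a) :: lift M (M.step p a) x

theorem getLast?_lift (x : List A) (hx : x ≠ []) (p : Q) :
    ∃ q a, (lift M p x).getLast? = some (q, a) ∧ M.step q a = M.evalFrom p (x.map Subtype.val) := by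
  induction x generalizing p with
  | nil => exact absurd rfl hx
  | cons a x ih =>
    by_cases h : x = []
    · subst h
      exact ⟨p, a, rfl, rfl⟩
    · obtain ⟨q, b, hq, hb⟩ := ih h (M.step p a)
      refine ⟨q, b, ?_, hb⟩
      rw [lift, List.getLast?_cons, hq]
      rfl

variable (e : Q → ℕ)

/-- The value of a row in the state with number `st` with register contents `σ`. The rows of a
state `q` express that the state is `q`, and the rows of an instruction express that it could be
carried out. -/
def rowValue (e : Q → ℕ) : (Q ⊕ A) × Bool → ℤ → (ℕ → ℤ) → ℤ
  | (.inl q, s), st, _ => (if s then 1 else -1) * (st - e q)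
  | (.inr a, s), _, σ => a.1.sign s * (linear a.1.form σ + a.1.const)

def rowLinear : (Q ⊕ A) × Bool → ℤ → (ℕ → ℤ) → ℤ
  | (.inl _, s), st, _ => (if s then 1 else -1) * st
  | (.inr a, s), _, σ => a.1.sign s * linear a.1.form σ

theorem rowValue_add (i : (Q ⊕ A) × Bool) (st d : ℤ) (σ δ : ℕ → ℤ) :
    rowValue e i (st + d) (σ + δ) = rowValue e i st σ + rowLinear i d δ := by
  obtain ⟨q | a, s⟩ := i
  · simp only [rowValue, rowLinear]
    ring
  · simp only [rowValue, rowLinear, linear_add]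
    ring

theorem rowLinear_mul (i : (Q ⊕ A) × Bool) (c : ℤ) (σ : ℕ → ℤ) :
    rowLinear i 0 (fun r => c * σ r) = c * rowLinear i 0 σ := by
  obtain ⟨q | a, s⟩ := i
  · simp [rowLinear]
  · simp only [rowLinear, linear_mul]
    ring

open Classical in
-- The rows of a state are in force only at transitions that lead to it, and the rows of an
-- instruction only at transitions that carry it out.
noncomputable def rowClosed (M : DFA Atom Q) : (Q ⊕ A) × Bool → Q × A → Bool
  | (.inl q, _), l => !decide (M.step l.1 l.2 = q)
  | (.inr a, _), l => !decide (l.2 = a)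

/-- The state total changes by the number of the target minus that of the source. Demanding that it
then equal the number of the target forces the source to be the actual state, so valid words are
exactly the automaton paths with executable instructions. -/
theorem valid_lift_iff (he : Function.Injective e) (w : List (Q × A)) (p : Q) (σ : ℕ → ℕ) :
    Valid (fun i l => rowLinear i ((e (M.step l.1 l.2) : ℤ) - e l.1) l.2.1.effect) (rowClosed M)
      (fun i => rowValue e i (e p) fun r => (σ r : ℤ)) w ↔
    ∃ x : List A, w = lift M p x ∧ ∃ τ, Run (x.map Subtype.val) σ τ := by
  induction w generalizing p σ with
  | nil =>
    simp only [Valid, true_iff]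
    exact ⟨[], rfl, σ, rfl⟩
  | cons l w ih =>
    obtain ⟨p', a⟩ := l
    simp only [Valid, ← rowValue_add]
    constructor
    · rintro ⟨h0, h⟩
      have hp : p' = p := by
        -- The two signs together give `e p + (e target - e p') = e target`, hence `e p' = e p`.
        have h1 := h0 (.inl (M.step p' a), true) (by simp [rowClosed])
        have h2 := h0 (.inl (M.step p' a), false) (by simp [rowClosed])
        simp only [rowValue] at h1 h2
        simp at h1 h2
        exact he (by omega)
      subst hp
      obtain ⟨ρ, hρ⟩ := (a.1.exists_step_iff σ).2 fun s => h0 (.inr a, s) (by simp [rowClosed])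
      rw [add_sub_cancel, ← hρ.effect, ih] at h
      obtain ⟨x, rfl, τ, hτ⟩ := h
      exact ⟨a :: x, rfl, τ, ρ, hρ, hτ⟩
    · rintro ⟨x, hx, τ, hτ⟩
      obtain _ | ⟨b, x⟩ := x
      · simp [lift] at hx
      simp only [lift, List.cons.injEq, Prod.mk.injEq] at hx
      obtain ⟨⟨rfl, rfl⟩, rfl⟩ := hx
      obtain ⟨ρ, hρ, hτ⟩ := hτ
      constructor
      · rintro ⟨q | b, s⟩ hc
        · have : M.step p' a = q := by simpa [rowClosed] using hc
          simp [rowValue, this]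
        · have : a = b := by simpa [rowClosed] using hc
          subst this
          exact (a.1.exists_step_iff σ).1 ⟨ρ, hρ⟩ s
      · rw [add_sub_cancel, ← hρ.effect, ih]
        exact ⟨x, rfl, τ, hτ⟩

end Lift

/-- The registers with the input `n`. -/
def initial (n r : ℕ) : ℕ := if r = 0 then n else 0

open Classical in
theorem exists_system_of_isRegular {L : Language Atom} (hL : L.IsRegular) (hne : [] ∉ L)
    {A : Set Atom} (hA : A.Finite) (hLA : ∀ w ∈ L, ∀ a ∈ w, a ∈ A) :
    ∃ S : System, ∀ n : ℕ, (∃ w : List ℕ, w ≠ [] ∧ (∀ x ∈ w, x ≤ S.J) ∧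
        S.Accepts n w.length fun t => w.getD t 0) ↔ ∃ w ∈ L, ∃ τ, Run w (initial n) τ := by
  obtain ⟨Q, _, M, rfl⟩ := hL
  -- Without instructions `L` is empty, because it does not contain the empty word. A system all of
  -- whose letters are bad accepts nothing.
  by_cases hempty : A = ∅
  · subst hempty
    obtain ⟨S, hS⟩ := exists_system (ι := Unit) (Λ := Unit) (fun _ _ => 0) (fun _ _ => true)
      (fun _ => 0) (fun _ => 0) (fun _ => true)
    refine ⟨S, fun n => (hS n).trans ⟨?_, ?_⟩⟩
    · rintro ⟨w, hw, -, h⟩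
      simpa using h _ (List.getLast?_eq_some_getLast hw)
    · rintro ⟨w, hw, -⟩
      obtain _ | ⟨a, w⟩ := w
      · exact absurd hw hne
      · exact absurd (hLA _ hw a (by simp)) (Set.notMem_empty a)
  have : Nonempty A := (Set.nonempty_iff_ne_empty.2 hempty).to_subtype
  have : Finite A := hA
  have : Nonempty Q := ⟨M.start⟩
  set e : Q → ℕ := fun q => Fintype.equivFin Q q
  have he : Function.Injective e := fun p q h => (Fintype.equivFin Q).injective (Fin.ext h)
  obtain ⟨S, hS⟩ := exists_system (ι := (Q ⊕ A) × Bool) (Λ := Q × A)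
    (fun i l => rowLinear i ((e (M.step l.1 l.2) : ℤ) - e l.1) l.2.1.effect) (rowClosed M)
    (fun i => rowValue e i (e M.start) 0) (fun i => rowLinear i 0 (Pi.single 0 1))
    (fun l => !decide (M.step l.1 l.2 ∈ M.accept))
  refine ⟨S, fun n => (hS n).trans ?_⟩
  -- The initial registers are `n` times a unit vector, so the initial row values are affine in `n`,
  -- as systems require.
  have hinit : (fun i : (Q ⊕ A) × Bool => rowValue e i (e M.start) 0 +
      n * rowLinear i 0 (Pi.single 0 1)) =
      fun i => rowValue e i (e M.start) fun r => (initial n r : ℤ) := by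
    funext i
    rw [← rowLinear_mul, ← rowValue_add]
    congr 1
    funext r
    by_cases hr : r = 0 <;> simp [initial, hr]
  rw [hinit]
  simp only [valid_lift_iff M e he]
  constructor
  · rintro ⟨_, hw, ⟨x, rfl, τ, hτ⟩, hlast⟩
    have hx : x ≠ [] := by
      rintro rfl
      exact hw rfl
    obtain ⟨q, a, h1, h2⟩ := getLast?_lift M x hx M.start
    refine ⟨x.map Subtype.val, ?_, τ, hτ⟩
    have := hlast _ h1
    rw [DFA.mem_accepts, DFA.eval, ← h2]
    simpa using this
  · rintro ⟨w, hw, τ, hτ⟩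
    obtain ⟨x, rfl⟩ : ∃ x : List A, x.map Subtype.val = w :=
      ⟨w.pmap (fun a h => ⟨a, h⟩) (hLA w hw), by simp [List.map_pmap]⟩
    have hx : x ≠ [] := by
      rintro rfl
      exact hne hw
    obtain ⟨q, a, h1, h2⟩ := getLast?_lift M x hx M.start
    refine ⟨lift M M.start x, ?_, ⟨x, rfl, τ, hτ⟩, ?_⟩
    · intro h
      rw [h] at h1
      simp at h1
    · intro l hl
      rw [h1, Option.mem_some_iff] at hl
      subst hl
      rw [DFA.mem_accepts, DFA.eval, ← h2] at hw
      simpa using hw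

/-! ### An undecidable system and the reduction -/

/-- There is a system for which it is undecidable whether some word is accepted for the input. -/
theorem exists_undecidable_system : ∃ S : System, ¬ComputablePred fun n : ℕ =>
    ∃ w : List ℕ, w ≠ [] ∧ (∀ x ∈ w, x ≤ S.J) ∧ S.Accepts n w.length fun t => w.getD t 0 := by
  have hu : Nat.Partrec fun n => (Denumerable.ofNat Nat.Partrec.Code n).eval 0 :=
    Partrec.nat_iff.1 (Nat.Partrec.Code.eval_part.comp (Computable.ofNat _) (Computable.const 0))
  -- Register `0` holds the code `n`, and the value in register `1` is quantified away; what remains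
  -- says that the code halts on input `0`.
  have hdef := ((definableGraph hu) 2 0 1 (by omega) (by omega)).ex (b := 1)
  obtain ⟨R, ⟨L, hL, ⟨A, hA, hLA⟩, hR⟩, hdef⟩ := hdef
  -- A test that always succeeds is put in front, since accepted words of a system are nonempty
  -- while a program might have the empty run.
  set a₀ := Atom.test [] 0
  have ha₀ (σ τ : ℕ → ℕ) : a₀.Step σ τ ↔ τ = σ := by simp [a₀, Atom.Step, linear]
  obtain ⟨S, hS⟩ := exists_system_of_isRegular ((Language.isRegular_singleton a₀).mul hL)
    (by rintro ⟨_, rfl, v, -, h⟩; simp at h) (hA.insert a₀) (by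
      rintro _ ⟨_, rfl, v, hv, rfl⟩ a ha
      rcases List.mem_cons.1 ha with rfl | ha
      exacts [.inl rfl, .inr (hLA v hv a ha)])
  have hrun (n : ℕ) : (∃ w ∈ ({[a₀]} : Language Atom) * L, ∃ τ, Run w (initial n) τ) ↔
      ((Denumerable.ofNat Nat.Partrec.Code n).eval 0).Dom := by
    have h1 := hdef (initial n) fun j hj => if_neg (by omega)
    have h2 : (∃ v, (Function.update (initial n) 1 v) 1 ∈
        (Denumerable.ofNat Nat.Partrec.Code ((Function.update (initial n) 1 v) 0)).eval 0) ↔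
        ((Denumerable.ofNat Nat.Partrec.Code n).eval 0).Dom := by
      rw [Part.dom_iff_mem]
      simp [initial]
    rw [← h2]
    constructor
    · rintro ⟨_, ⟨_, rfl, v, hv, rfl⟩, τ, ρ, h, hτ⟩
      rw [ha₀] at h
      subst h
      exact ((h1 τ).1 ((hR _ _).2 ⟨v, hv, hτ⟩)).2
    · intro h
      obtain ⟨v, hv, hτ⟩ := (hR _ _).1 ((h1 _).2 ⟨rfl, h⟩)
      exact ⟨[a₀] ++ v, Language.append_mem_mul rfl hv, _, _, (ha₀ _ _).2 rfl, hτ⟩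
  refine ⟨S, fun hS' => ComputablePred.halting_problem 0 ?_⟩
  have h2 : ComputablePred fun n : ℕ => ((Denumerable.ofNat Nat.Partrec.Code n).eval 0).Dom :=
    hS'.of_eq fun n => (hS n).trans (hrun n)
  refine ComputablePred.computable_of_manyOneReducible ?_ h2
  exact ⟨Encodable.encode, Computable.encode, fun c => by simp⟩

/-- Undecidability is inherited along a computable family of instances. -/
theorem not_decidableOn {α : Type} [Primcodable α] {C : Set α} {P : α → Prop} {p : ℕ → Prop}
    (hp : ¬ComputablePred p) {f : ℕ → α} (hf : Computable f) (hC : ∀ n, f n ∈ C)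
    (hP : ∀ n, P (f n) ↔ p n) : ¬DecidableOn C P := by
  rintro ⟨R, hR, h⟩
  exact hp (ComputablePred.computable_of_manyOneReducible
    ⟨f, hf, fun n => ((h _ (hC n)).trans (hP n)).symm⟩ hR)

end TransformerSat

theorem theorem2 (start : ℕ) (hstart : start = 0 ∨ start = 1) :
    (¬ TransformerSat.DecidableOn
        {x : TransformerSat.TE × TransformerSat.LogPrecision | x.1.WellFormed}
        (fun x => x.1.Satisfiable start x.2)) ∧
    ∃ c : ℕ, ∀ F : TransformerSat.LogPrecision, c ≤ F.intRate → c ≤ F.fracRate →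
      ¬ TransformerSat.DecidableOn {T : TransformerSat.TE | T.WellFormed}
          (fun T => T.Satisfiable start F) := by
  obtain ⟨S, hS⟩ := TransformerSat.exists_undecidable_system
  have hs : start ≤ 1 := by omega
  constructor
  · let F : TransformerSat.LogPrecision := ⟨.down, .saturate, 17, 0, 17, 0⟩
    exact TransformerSat.not_decidableOn hS
      (f := fun n => (S.encoder n, F))
      (S.primrec_encoder.to_comp.pair (Computable.const F)) S.encoder_wellFormed
      fun _ => S.encoder_satisfiable F le_rfl le_rfl hs
  · exact ⟨17, fun F h1 h2 => TransformerSat.not_decidableOn hS S.primrec_encoder.to_comp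
      S.encoder_wellFormed fun _ => S.encoder_satisfiable F h1 h2 hs⟩
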